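/- Fix $d,e\in\mathbb N$, a real $p\ge 1$, an integer $N>p-1$, vector fields $V_1,\dots,V_d\in\mathrm{Lip}^N(\mathbb R^e)$ (that is, each $V_i$ is $C^{N-1}$, it and its derivatives up to order $N-1$ are bounded, and its derivative of order $N-1$ is Lipschitz continuous), and $M_2\in\mathbb R$. Put $\theta=\frac{N+1}{p}>1$. Notation. For a Lipschitz path $x$ in $\mathbb R^d$ let $$S_N(x)_{s,t}=\big(\mathbf g^{k,i_1,\dots,i_k}\big)_{0\le k\le N},\qquad \mathbf g^{k,i_1,\dots,i_k}=\int_s^t\int_s^{u_k}\cdots\int_s^{u_2}dx^{i_1}_{u_1}\cdots dx^{i_k}_{u_k},\quad \mathbf g^0=1,$$ be its step-$N$ signature. For a signature $\mathbf g$ let $\|\mathbf g\|=\inf\int_0^1|\dot\gamma_t|\,dt$ over all Lipschitz $\gamma:[0,1]\to\mathbb R^d$ with $\gamma(0)=0$ and $S_N(\gamma)_{0,1}=\mathbf g$ (the Carnot–Carathéodory norm), and for $x:[0,1]\to\mathbb R^d$ let $\|S_N(x)\|_{1/p\text{-Höl}}=\sup_{0\le s<t\le 1}\|S_N(x)_{s,t}\|/(t-s)^{1/p}$.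 Let $\pi(a,y_a;x)$ denote the solution of $dy=\sum_i V_i(y)\,dx^i$ with value $y_a$ at time $a$. For a path $y$ write $y_{s,t}=y_t-y_s$. Finally let $I[y,N,\mathbf g]=\sum_{k=1}^N\sum_{i_1,\dots,i_k}V_{i_1}\cdots V_{i_k}H(y)\,\mathbf g^{k,i_1,\dots,i_k}$, where $H$ is the identity function of $\mathbb R^e$ and vector fields act as first order differential operators. Claim. There are positive constants $C(M_1)$ (for $M_1\ge 0$) and $C'(K,M_1)$ (for $K>0$, $M_1\ge 0$), depending besides the displayed arguments only on $p,N,M_2,V_1,\dots,V_d$, such that the following holds. 1. (Generalized Davie Lemma.) Let $M_1\ge 0$, let $x:[0,1]\to\mathbb R^d$ be Lipschitz with $\|S_N(x)\|_{1/p\text{-Höl}}\le M_1$, let $|y_0|\le M_2$, and let $y=\pi(0,y_0;x)$. Then $$|y_{s,t}|<C(M_1)(t-s)^{1/p}\quad(0\le s<t\le 1),\qquad \big|y_{s,t}-I[y_s,N,S_N(x)_{s,t}]\big|\le C(M_1)(t-s)^{\theta}\quad(0\le s\le t\le 1).$$ Moreover, if $K>0$, $0\le s\le t\le 1$ and $x^{s,t}:[s,t]\to\mathbb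 R^d$ is a Lipschitz path with $S_N(x^{s,t})_{s,t}=S_N(x)_{s,t}$ and length $\int_s^t|dx^{s,t}|\le K M_1(t-s)^{1/p}$, then $$\big|y_{s,t}-\pi(s,y_s;x^{s,t})_{s,t}\big|\le C'(K,M_1)(t-s)^{\theta}.$$ 2. (Growth of the constants.) There is a constant $c$, depending only on $p,N,M_2,V_1,\dots,V_d$, such that for all $M_1\ge 1$ $$C(M_1)\le c\,\exp\!\big(12N^2(\ln M_1)^2\big),$$ and $\ln C(M_1)=O\big((\ln M_1)^2\big)$ as $M_1\to\infty$. For every $K>0$ the same two statements hold for $C'(K,\cdot)$, with a constant $c$ (and an implied constant) that may also depend on $K$. -/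

import Mathlib

noncomputable section

open MeasureTheory
open scoped ENNReal NNReal

namespace DavieEstimate

/-- The Euclidean space `ℝⁿ`. -/
abbrev Euc (n : ℕ) : Type := EuclideanSpace ℝ (Fin n)

/-- `x` is a Lipschitz path on `[a, b]`; values outside `[a, b]` are irrelevant. -/
def IsLipschitzPath {d : ℕ} (x : ℝ → Euc d) (a b : ℝ) : Prop :=
  ∃ L : ℝ≥0, LipschitzOnWith L x (Set.Icc a b)

/-- The length `∫_a^b |dx| = ∫_a^b |x'(r)| dr` of a Lipschitz path. -/
def pathLength {d : ℕ} (x : ℝ → Euc d) (a b : ℝ) : ℝ :=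
  ∫ r in a..b, ‖deriv x r‖

/-- The iterated integral `∫_s^t ∫_s^{u_k} ⋯ ∫_s^{u_2} dx^{i_1}_{u_1} ⋯ dx^{i_k}_{u_k}`
of a Lipschitz path, for the multi-index `I = (i_1, …, i_k)`. -/
def iteratedIntegral {d : ℕ} (x : ℝ → Euc d) (s : ℝ) : (k : ℕ) → (Fin k → Fin d) → ℝ → ℝ
  | 0, _, _ => 1
  | k + 1, I, t =>
      ∫ u in s..t, iteratedIntegral x s k (Fin.init I) u * deriv x u (I (Fin.last k))

/-- The truncated tensor space `⊕_{k ≤ N} (ℝ^d)^{⊗ k}`, in coordinates `g^{k, i_1, …, i_k}`. -/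
abbrev TruncTensor (d N : ℕ) : Type := (k : Fin (N + 1)) → (Fin (k : ℕ) → Fin d) → ℝ

/-- The step-`N` signature `S_N(x)_{s,t}`. -/
def signature {d : ℕ} (N : ℕ) (x : ℝ → Euc d) (s t : ℝ) : TruncTensor d N :=
  fun k I => iteratedIntegral x s k I t

/-- The Carnot-Caratheodory norm: the infimum of the lengths of all Lipschitz paths
`γ : [0, 1] → ℝ^d` with `γ(0) = 0` and `S_N(γ)_{0,1} = g` (it is `∞` if there is no such path). -/
def ccNorm {d N : ℕ} (g : TruncTensor d N) : ℝ≥0∞ :=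
  ⨅ (γ : ℝ → Euc d)
    (_ : IsLipschitzPath γ 0 1 ∧ γ 0 = 0 ∧ signature N γ 0 1 = g),
    ENNReal.ofReal (pathLength γ 0 1)

/-- The homogeneous `1/p`-Hölder norm `sup_{0 ≤ s < t ≤ 1} ‖X_{s,t}‖ / (t - s)^{1/p}`, as a
function of the increments `X_{s,t}`. -/
def holderNorm {d N : ℕ} (p : ℝ) (X : ℝ → ℝ → TruncTensor d N) : ℝ≥0∞ :=
  ⨆ (s : ℝ) (t : ℝ) (_ : 0 ≤ s ∧ s < t ∧ t ≤ 1),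
    ccNorm (X s t) / ENNReal.ofReal ((t - s) ^ (1 / p))

/-- `V ∈ Lip^N(ℝ^e)` for an integer `N ≥ 1`: `V` is `N - 1` times continuously differentiable,
`V` and its derivatives of order at most `N - 1` are bounded, and the derivative of order `N - 1`
is Lipschitz continuous. For `N = 1` this says: bounded and Lipschitz continuous. -/
structure IsLip {e : ℕ} (N : ℕ) (V : Euc e → Euc e) : Prop where
  contDiff : ContDiff ℝ ((N - 1 : ℕ) : ℕ∞) V
  bounded : ∀ k ≤ N - 1, ∃ B : ℝ, ∀ y, ‖iteratedFDeriv ℝ k V y‖ ≤ B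
  lipschitz : ∃ L : ℝ≥0, LipschitzWith L (iteratedFDeriv ℝ (N - 1) V)

/-- `y` is the solution `π(a, y₀; x)` on `[a, b]` of `dy = ∑ᵢ Vᵢ(y) dxⁱ` started at `y₀` at
time `a`. -/
def IsSolution {d e : ℕ} (V : Fin d → Euc e → Euc e) (x : ℝ → Euc d) (a b : ℝ)
    (y₀ : Euc e) (y : ℝ → Euc e) : Prop :=
  ContinuousOn y (Set.Icc a b) ∧
    ∀ t ∈ Set.Icc a b, y t = y₀ + ∑ i : Fin d, ∫ r in a..t, (deriv x r i) • V i (y r)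

/-- The vector field `W`, as a first order differential operator, applied to `f`. -/
def lieDeriv {e : ℕ} (W : Euc e → Euc e) (f : Euc e → Euc e) : Euc e → Euc e :=
  fun y => fderiv ℝ f y (W y)

/-- `V_{i_1} ⋯ V_{i_k} H`, where `H` is the identity function of `ℝ^e`. -/
def iteratedLieDeriv {d e : ℕ} (V : Fin d → Euc e → Euc e) :
    (k : ℕ) → (Fin k → Fin d) → Euc e → Euc e
  | 0, _ => id
  | k + 1, I => lieDeriv (V (I 0)) (iteratedLieDeriv V k (Fin.tail I))

/-- The increment of the step-`N` Euler scheme,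
`I[y, N, g] = ∑_{k=1}^N ∑_{i_1, …, i_k} g^{k, i_1, …, i_k} V_{i_1} ⋯ V_{i_k} H(y)`. -/
def eulerIncrement {d e N : ℕ} (V : Fin d → Euc e → Euc e) (y : Euc e)
    (g : TruncTensor d N) : Euc e :=
  ∑ k : Fin (N + 1), if (k : ℕ) = 0 then 0 else
    ∑ I : Fin (k : ℕ) → Fin d, g k I • iteratedLieDeriv V k I y

/-- `C` is an admissible constant, for the bounds `M₁` on the Hölder norm of the lifted driving
signal and `M₂` on the starting point, in the Hölder estimate and in the step-`N` Euler estimate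
for solutions of `dy = V(y) dx`. -/
def IsDavieConstant {d e : ℕ} (p : ℝ) (N : ℕ) (V : Fin d → Euc e → Euc e)
    (M₂ M₁ C : ℝ) : Prop :=
  ∀ (x : ℝ → Euc d) (y₀ : Euc e) (y : ℝ → Euc e),
    IsLipschitzPath x 0 1 →
    holderNorm p (signature N x) ≤ ENNReal.ofReal M₁ →
    ‖y₀‖ ≤ M₂ →
    IsSolution V x 0 1 y₀ y →
    (∀ s t : ℝ, 0 ≤ s → s < t → t ≤ 1 → ‖y t - y s‖ < C * (t - s) ^ (1 / p)) ∧
    (∀ s t : ℝ, 0 ≤ s → s ≤ t → t ≤ 1 →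
      ‖(y t - y s) - eulerIncrement V (y s) (signature N x s t)‖
        ≤ C * (t - s) ^ (((N : ℝ) + 1) / p))

/-- `C'` is an admissible constant in the geodesic approximation estimate: the solution `y` is
compared on `[s, t]` with the solution `w` started at `y s` and driven by any Lipschitz path `z`
on `[s, t]` that has the same step-`N` signature as `x` over `[s, t]` and length at most
`K M₁ (t - s)^{1/p}`. -/
def IsDavieGeodesicConstant {d e : ℕ} (p : ℝ) (N : ℕ) (V : Fin d → Euc e → Euc e)
    (M₂ K M₁ C' : ℝ) : Prop :=
  ∀ (x : ℝ → Euc d) (y₀ : Euc e) (y : ℝ → Euc e),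
    IsLipschitzPath x 0 1 →
    holderNorm p (signature N x) ≤ ENNReal.ofReal M₁ →
    ‖y₀‖ ≤ M₂ →
    IsSolution V x 0 1 y₀ y →
    ∀ (s t : ℝ), 0 ≤ s → s ≤ t → t ≤ 1 →
    ∀ (z : ℝ → Euc d) (w : ℝ → Euc e),
      IsLipschitzPath z s t →
      signature N z s t = signature N x s t →
      pathLength z s t ≤ K * M₁ * (t - s) ^ (1 / p) →
      IsSolution V z s t (y s) w →
      ‖(y t - y s) - (w t - w s)‖ ≤ C' * (t - s) ^ (((N : ℝ) + 1) / p)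

end DavieEstimate

end

noncomputable section

open MeasureTheory
open scoped ENNReal NNReal

namespace DavieEstimate

/-! The constants obtained are polynomial, of the form `c * (max M₁ 1) ^ (2 * N + 2)`; a polynomial
in `M₁` is dominated by `exp (a (ln M₁)²)` for every `a > 0`, so both growth statements follow.

Along a Lipschitz path of length `ℓ` the step-`N` Euler scheme has error at most `E ℓ^(N+1)`, by
iterating the chain rule (`exists_norm_sub_eulerIncrement_le`). The Hölder norm of the lift does not
control the length of `x`, but the scheme only sees signatures. On adjacent intervals `[s, t]`, `[t,
u]` one therefore replaces `x` by almost shortest paths with the same signatures and compares with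
the solution driven by their concatenation. With `ρ = M (u - s)^(1/p)` small, the Euler defect `D`
of `y` satisfies `|D_{s,u}| ≤ (1 + Cρ)|D_{s,t}| + |D_{t,u}| + C ρ^(N+1)`
(`exists_norm_eulerDefect_le_add`).

Taking `t` to be the midpoint turns a bound `Q ρ^(N+1)` on short intervals into `(κ Q + C) ρ^(N+1)`,
where `κ < 1` because `2^((N+1)/p) > 2`. Iteration starts from a crude bound involving the Lipschitz
constant of `x`; in the limit that constant disappears (`exists_norm_eulerDefect_le_of_short`).

Longer intervals are cut into about `M^p` short ones. The vector fields being bounded, the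
increments of `y` over the pieces simply add, so this costs only powers of `M`
(`exists_polynomial_davie_constant`). In the geodesic estimate both solutions have the same Euler
increment, and the two errors add. -/

/-- `f` has `n` bounded derivatives, and the last one is bounded and Lipschitz continuous. -/
def IsLipReg {E : Type} [NormedAddCommGroup E] [NormedSpace ℝ E] :
    (n : ℕ) → {F : Type} → [NormedAddCommGroup F] → [NormedSpace ℝ F] → (E → F) → Prop
  | 0, _, _, _, f => (∃ B : ℝ, ∀ y, ‖f y‖ ≤ B) ∧ ∃ L : ℝ≥0, LipschitzWith L f
  | n + 1, _, _, _, f =>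
      (∃ B : ℝ, ∀ y, ‖f y‖ ≤ B) ∧ Differentiable ℝ f ∧ IsLipReg n (fderiv ℝ f)

/-! ### Calculus of bounded Lipschitz regularity -/

namespace IsLipReg

variable {E F G H : Type} [NormedAddCommGroup E] [NormedSpace ℝ E]
  [NormedAddCommGroup F] [NormedSpace ℝ F] [NormedAddCommGroup G] [NormedSpace ℝ G]
  [NormedAddCommGroup H] [NormedSpace ℝ H]

theorem bounded {n : ℕ} {f : E → F} (hf : IsLipReg n f) : ∃ B : ℝ, ∀ y, ‖f y‖ ≤ B := by
  cases n with
  | zero => exact hf.1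
  | succ n => exact hf.1

theorem lipschitz {n : ℕ} {f : E → F} (hf : IsLipReg n f) : ∃ L : ℝ≥0, LipschitzWith L f := by
  cases n with
  | zero => exact hf.2
  | succ n =>
    obtain ⟨B, hB⟩ := hf.2.2.bounded
    refine ⟨B.toNNReal, lipschitzWith_of_nnnorm_fderiv_le hf.2.1 fun y => ?_⟩
    exact NNReal.le_toNNReal_of_coe_le (hB y)

theorem of_succ {n : ℕ} {f : E → F} (hf : IsLipReg (n + 1) f) : IsLipReg n f := by
  induction n generalizing F with
  | zero => exact ⟨hf.bounded, hf.lipschitz⟩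
  | succ n ih => exact ⟨hf.1, hf.2.1, ih hf.2.2⟩

theorem of_le {m n : ℕ} (h : m ≤ n) {f : E → F} (hf : IsLipReg n f) : IsLipReg m f := by
  induction h with
  | refl => exact hf
  | step _ ih => exact ih hf.of_succ

theorem add {n : ℕ} {f g : E → F} (hf : IsLipReg n f) (hg : IsLipReg n g) :
    IsLipReg n (fun y => f y + g y) := by
  have hb : ∃ B : ℝ, ∀ y, ‖f y + g y‖ ≤ B := by
    obtain ⟨B, hB⟩ := hf.bounded
    obtain ⟨B', hB'⟩ := hg.bounded
    exact ⟨B + B', fun y => (norm_add_le _ _).trans (add_le_add (hB y) (hB' y))⟩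
  induction n generalizing F with
  | zero =>
    obtain ⟨L, hL⟩ := hf.lipschitz
    obtain ⟨L', hL'⟩ := hg.lipschitz
    exact ⟨hb, L + L', hL.add hL'⟩
  | succ n ih =>
    refine ⟨hb, hf.2.1.add hg.2.1, ?_⟩
    have : fderiv ℝ (fun y => f y + g y) = fun y => fderiv ℝ f y + fderiv ℝ g y := by
      funext y
      exact fderiv_fun_add (hf.2.1 y) (hg.2.1 y)
    rw [this]
    obtain ⟨B, hB⟩ := hf.2.2.bounded
    obtain ⟨B', hB'⟩ := hg.2.2.bounded
    exact ih hf.2.2 hg.2.2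
      ⟨B + B', fun y => (norm_add_le _ _).trans (add_le_add (hB y) (hB' y))⟩

omit [NormedAddCommGroup E] [NormedSpace ℝ E] in
theorem bilinear_bounded (B : F →L[ℝ] G →L[ℝ] H) {f : E → F} {g : E → G}
    (hf : ∃ b : ℝ, ∀ y, ‖f y‖ ≤ b) (hg : ∃ b : ℝ, ∀ y, ‖g y‖ ≤ b) :
    ∃ b : ℝ, ∀ y, ‖B (f y) (g y)‖ ≤ b := by
  obtain ⟨b, hb⟩ := hf
  obtain ⟨b', hb'⟩ := hg
  refine ⟨‖B‖ * b * b', fun y => (B.le_opNorm₂ _ _).trans ?_⟩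
  have := (norm_nonneg _).trans (hb y)
  have := hb y
  have := hb' y
  gcongr

/-- The product rule yields two terms of the same shape with new bilinear maps, so the induction
must let the target spaces and `B` vary. -/
theorem bilinear {n : ℕ} (B : F →L[ℝ] G →L[ℝ] H) {f : E → F} {g : E → G}
    (hf : IsLipReg n f) (hg : IsLipReg n g) : IsLipReg n (fun y => B (f y) (g y)) := by
  induction n generalizing F G H with
  | zero =>
    refine ⟨bilinear_bounded B hf.bounded hg.bounded, ?_⟩
    obtain ⟨L, hL⟩ := hf.lipschitz
    obtain ⟨L', hL'⟩ := hg.lipschitz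
    obtain ⟨b, hb⟩ := hf.bounded
    obtain ⟨b', hb'⟩ := hg.bounded
    refine ⟨(‖B‖ * b * L' + ‖B‖ * L * b').toNNReal, LipschitzWith.of_dist_le_mul fun x y => ?_⟩
    refine le_trans ?_ (mul_le_mul_of_nonneg_right (Real.le_coe_toNNReal _) dist_nonneg)
    have e : B (f x) (g x) - B (f y) (g y) = B (f x) (g x - g y) + B (f x - f y) (g y) := by
      simp
    rw [dist_eq_norm, e]
    have h1 := hL.dist_le_mul x y
    have h2 := hL'.dist_le_mul x y
    have hb0 := (norm_nonneg _).trans (hb x)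
    have hbx := hb x
    have hby := hb' y
    rw [dist_eq_norm] at h1 h2
    calc ‖B (f x) (g x - g y) + B (f x - f y) (g y)‖
        ≤ ‖B‖ * ‖f x‖ * ‖g x - g y‖ + ‖B‖ * ‖f x - f y‖ * ‖g y‖ :=
          (norm_add_le _ _).trans (add_le_add (B.le_opNorm₂ _ _) (B.le_opNorm₂ _ _))
      _ ≤ ‖B‖ * b * (L' * dist x y) + ‖B‖ * (L * dist x y) * b' := by gcongr
      _ = _ := by ring
  | succ n ih =>
    refine ⟨bilinear_bounded B hf.bounded hg.bounded, fun y => ?_, ?_⟩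
    · exact (B.hasFDerivAt_of_bilinear (hf.2.1 y).hasFDerivAt
        (hg.2.1 y).hasFDerivAt).differentiableAt
    · have : fderiv ℝ (fun y => B (f y) (g y)) = fun y =>
          B.precompR E (f y) (fderiv ℝ g y) + B.precompL E (fderiv ℝ f y) (g y) := by
        funext y
        exact (B.hasFDerivAt_of_bilinear (hf.2.1 y).hasFDerivAt (hg.2.1 y).hasFDerivAt).fderiv
      rw [this]
      exact add (ih _ hf.of_succ hg.2.2) (ih _ hf.2.2 hg.of_succ)

theorem lieDeriv {e n : ℕ} {W f : Euc e → Euc e} (hf : IsLipReg (n + 1) f) (hW : IsLipReg n W) :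
    IsLipReg n (lieDeriv W f) :=
  bilinear (ContinuousLinearMap.id ℝ (Euc e →L[ℝ] Euc e)) hf.2.2 hW

/-- The iterated derivatives of `f` and those of `fderiv ℝ f` correspond under a linear isometry
with order shifted by one, so bounds and Lipschitz constants pass to the recursive predicate. -/
theorem of_iteratedFDeriv {n : ℕ} {f : E → F} (hd : ContDiff ℝ (n : ℕ∞) f)
    (hb : ∀ k ≤ n, ∃ B : ℝ, ∀ y, ‖iteratedFDeriv ℝ k f y‖ ≤ B)
    (hl : ∃ L : ℝ≥0, LipschitzWith L (iteratedFDeriv ℝ n f)) : IsLipReg n f := by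
  have h0 : ∃ B : ℝ, ∀ y, ‖f y‖ ≤ B := by simpa using hb 0 (Nat.zero_le _)
  induction n generalizing F with
  | zero =>
    obtain ⟨L, hL⟩ := hl
    refine ⟨h0, L, fun x y => ?_⟩
    have := hL x y
    rwa [iteratedFDeriv_zero_eq_comp, Function.comp_apply, Function.comp_apply,
      LinearIsometryEquiv.edist_map] at this
  | succ n ih =>
    have hd' : ContDiff ℝ ((n : ℕ) : ℕ∞) (fderiv ℝ f) := by
      have : ContDiff ℝ ((n : WithTop ℕ∞) + 1) f := by exact_mod_cast hd
      exact_mod_cast (contDiff_succ_iff_fderiv.1 this).2.2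
    refine ⟨h0, hd.differentiable (by simp), ih hd' (fun k hk => ?_) ?_ ?_⟩
    · simpa only [norm_iteratedFDeriv_fderiv] using hb (k + 1) (by omega)
    · obtain ⟨L, hL⟩ := hl
      refine ⟨L, fun x y => ?_⟩
      have := hL x y
      rwa [iteratedFDeriv_succ_eq_comp_right, iteratedFDeriv_succ_eq_comp_right,
        Function.comp_apply, Function.comp_apply, LinearIsometryEquiv.edist_map] at this
    · simpa using hb 1 (by omega)

end IsLipReg

theorem IsLip.isLipReg {e N : ℕ} {W : Euc e → Euc e} (h : IsLip N W) : IsLipReg (N - 1) W :=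
  .of_iteratedFDeriv h.contDiff h.bounded h.lipschitz

theorem lieDeriv_id {e : ℕ} (W : Euc e → Euc e) : lieDeriv W id = W := by
  funext y
  simp [lieDeriv]

/-- The innermost field acts on the identity at no cost, so a word of `k + 1` letters uses up only
`k` derivatives. With `n = N - 1`, all words of length `1` to `N` remain bounded and Lipschitz. -/
theorem isLipReg_iteratedLieDeriv {d e n : ℕ} {V : Fin d → Euc e → Euc e}
    (hV : ∀ i, IsLipReg n (V i)) (k : ℕ) (hk : k ≤ n) (I : Fin (k + 1) → Fin d) :
    IsLipReg (n - k) (iteratedLieDeriv V (k + 1) I) := by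
  induction k with
  | zero =>
    have : iteratedLieDeriv V (0 + 1) I = V (I 0) := lieDeriv_id _
    rw [this]
    exact hV _
  | succ k ih =>
    have h := ih (by omega) (Fin.tail I)
    rw [show n - k = n - (k + 1) + 1 by omega] at h
    exact h.lieDeriv ((hV _).of_le (by omega))

/-! ### Lengths, iterated integrals and Chen's relation -/

section Paths

variable {d : ℕ} {x : ℝ → Euc d} {a b : ℝ}

theorem IsLipschitzPath.mono {s t : ℝ} (hx : IsLipschitzPath x a b) (hs : a ≤ s) (ht : t ≤ b) :
    IsLipschitzPath x s t := by
  obtain ⟨L, hL⟩ := hx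
  exact ⟨L, hL.mono (Set.Icc_subset_Icc hs ht)⟩

theorem IsLipschitzPath.exists_norm_deriv_le (hx : IsLipschitzPath x a b) :
    ∃ L : ℝ, 0 ≤ L ∧ ∀ r ∈ Set.Ioo a b, ‖deriv x r‖ ≤ L := by
  obtain ⟨L, hL⟩ := hx
  exact ⟨L, L.2, fun r hr => norm_deriv_le_of_lipschitzOn (Icc_mem_nhds hr.1 hr.2) hL⟩

theorem IsLipschitzPath.intervalIntegrable {u v : ℝ} (hx : IsLipschitzPath x a b)
    (hu : u ∈ Set.Icc a b) (hv : v ∈ Set.Icc a b) : IntervalIntegrable (deriv x) volume u v := by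
  obtain ⟨L, -, hL⟩ := hx.exists_norm_deriv_le
  have h : IntegrableOn (deriv x) (Set.Ioo a b) := by
    refine Measure.integrableOn_of_bounded (M := L) (by simp)
      (measurable_deriv x).aestronglyMeasurable ?_
    exact (ae_restrict_iff' measurableSet_Ioo).2 (Filter.Eventually.of_forall hL)
  have h' : IntervalIntegrable (deriv x) volume a b :=
    (intervalIntegrable_iff_integrableOn_Ioo_of_le (hu.1.trans hu.2)).2 h
  refine h'.mono_set ?_
  rw [Set.uIcc_of_le (hu.1.trans hu.2)]
  exact Set.uIcc_subset_Icc hu hv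

theorem IsLipschitzPath.intervalIntegrable_apply {u v : ℝ} (hx : IsLipschitzPath x a b)
    (hu : u ∈ Set.Icc a b) (hv : v ∈ Set.Icc a b) (i : Fin d) :
    IntervalIntegrable (fun r => deriv x r i) volume u v :=
  have h := hx.intervalIntegrable hu hv
  ⟨(EuclideanSpace.proj i : Euc d →L[ℝ] ℝ).integrable_comp h.1,
    (EuclideanSpace.proj i : Euc d →L[ℝ] ℝ).integrable_comp h.2⟩

theorem IsLipschitzPath.intervalIntegrable_smul {F : Type} [NormedAddCommGroup F]
    [NormedSpace ℝ F] {u v : ℝ} (hx : IsLipschitzPath x a b)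
    (hu : u ∈ Set.Icc a b) (hv : v ∈ Set.Icc a b) (i : Fin d) {φ : ℝ → F}
    (hφ : ContinuousOn φ (Set.Icc a b)) :
    IntervalIntegrable (fun r => deriv x r i • φ r) volume u v :=
  (hx.intervalIntegrable_apply hu hv i).smul_continuousOn
    (hφ.mono (Set.uIcc_subset_Icc hu hv))

theorem IsLipschitzPath.norm_integral_smul_le {F : Type} [NormedAddCommGroup F]
    [NormedSpace ℝ F] {s t B : ℝ} (hx : IsLipschitzPath x s t) (hst : s ≤ t) (i : Fin d)
    {φ : ℝ → F} (hφ : ∀ r ∈ Set.Icc s t, ‖φ r‖ ≤ B) :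
    ‖∫ r in s..t, deriv x r i • φ r‖ ≤ B * pathLength x s t := by
  have hI := (hx.intervalIntegrable (Set.left_mem_Icc.2 hst) (Set.right_mem_Icc.2 hst)).norm
  rw [pathLength, ← intervalIntegral.integral_const_mul]
  refine intervalIntegral.norm_integral_le_of_norm_le hst
    (Filter.Eventually.of_forall fun r hr => ?_) (hI.const_mul B)
  rw [norm_smul, mul_comm]
  exact mul_le_mul (hφ r ⟨hr.1.le, hr.2⟩) (PiLp.norm_apply_le _ _) (norm_nonneg _)
    ((norm_nonneg _).trans (hφ r ⟨hr.1.le, hr.2⟩))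

theorem pathLength_nonneg {s t : ℝ} (hst : s ≤ t) : 0 ≤ pathLength x s t :=
  intervalIntegral.integral_nonneg hst fun _ _ => norm_nonneg _

theorem IsLipschitzPath.pathLength_add {s t u : ℝ} (hx : IsLipschitzPath x a b)
    (hs : s ∈ Set.Icc a b) (ht : t ∈ Set.Icc a b) (hu : u ∈ Set.Icc a b) :
    pathLength x s t + pathLength x t u = pathLength x s u :=
  intervalIntegral.integral_add_adjacent_intervals
    (hx.intervalIntegrable hs ht).norm (hx.intervalIntegrable ht hu).norm

theorem IsLipschitzPath.pathLength_mono {s t u : ℝ} (hx : IsLipschitzPath x s u)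
    (hst : s ≤ t) (htu : t ≤ u) : pathLength x s t ≤ pathLength x s u := by
  rw [← hx.pathLength_add ⟨le_rfl, hst.trans htu⟩ ⟨hst, htu⟩ ⟨hst.trans htu, le_rfl⟩]
  exact le_add_of_nonneg_right (pathLength_nonneg htu)

/-- Not quantitative: `L` is not controlled by the Hölder norm. It only seeds the bisection
argument, where it drops out in the limit. -/
theorem IsLipschitzPath.exists_pathLength_le (hx : IsLipschitzPath x a b) :
    ∃ L : ℝ, 0 ≤ L ∧ ∀ s t, a ≤ s → s ≤ t → t ≤ b → pathLength x s t ≤ L * (t - s) := by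
  obtain ⟨L, hL0, hL⟩ := hx.exists_norm_deriv_le
  refine ⟨L, hL0, fun s t hs hst ht => ?_⟩
  have hI := (hx.intervalIntegrable ⟨hs, hst.trans ht⟩ ⟨hs.trans hst, ht⟩).norm
  rw [pathLength, show L * (t - s) = ∫ _ in s..t, L by simp [mul_comm]]
  refine intervalIntegral.integral_mono_on_of_le_Ioo hst hI (by simp) fun r hr => hL r ?_
  exact ⟨hs.trans_lt hr.1, hr.2.trans_le ht⟩

/-- The iterated integral indexed by a word; the head of the word belongs to the outermost
integral. -/
def wordIntegral (x : ℝ → Euc d) (s : ℝ) : List (Fin d) → ℝ → ℝ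
  | [], _ => 1
  | i :: w, t => ∫ u in s..t, wordIntegral x s w u * deriv x u i

/-- A multi-index as a word, read backwards. -/
def indexWord : (k : ℕ) → (Fin k → Fin d) → List (Fin d)
  | 0, _ => []
  | k + 1, I => I (Fin.last k) :: indexWord k (Fin.init I)

theorem length_indexWord (k : ℕ) (I : Fin k → Fin d) : (indexWord k I).length = k := by
  induction k with
  | zero => rfl
  | succ k ih => simp [indexWord, ih]

theorem exists_indexWord_eq (w : List (Fin d)) : ∃ I, indexWord w.length I = w := by
  induction w with
  | nil => exact ⟨Fin.elim0, rfl⟩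
  | cons i w ih =>
    obtain ⟨I, hI⟩ := ih
    exact ⟨Fin.snoc (α := fun _ => Fin d) I i, by simp [indexWord, hI]⟩

theorem iteratedIntegral_eq_wordIntegral (x : ℝ → Euc d) (s : ℝ) (k : ℕ) (I : Fin k → Fin d)
    (t : ℝ) : iteratedIntegral x s k I t = wordIntegral x s (indexWord k I) t := by
  induction k generalizing t with
  | zero => rfl
  | succ k ih => simp only [iteratedIntegral, indexWord, wordIntegral, ih]

theorem signature_eq_iff {N : ℕ} {z : ℝ → Euc d} {s t s' t' : ℝ} :
    signature N x s t = signature N z s' t' ↔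
      ∀ w : List (Fin d), w.length ≤ N → wordIntegral x s w t = wordIntegral z s' w t' := by
  constructor
  · intro h w hw
    obtain ⟨I, hI⟩ := exists_indexWord_eq w
    have := congrFun (congrFun h ⟨w.length, by omega⟩) I
    simpa [signature, iteratedIntegral_eq_wordIntegral, hI] using this
  · intro h
    funext k I
    simp only [signature, iteratedIntegral_eq_wordIntegral]
    exact h _ (by rw [length_indexWord]; omega)

theorem IsLipschitzPath.continuousOn_wordIntegral {s : ℝ} (hx : IsLipschitzPath x a b)
    (hs : s ∈ Set.Icc a b) (w : List (Fin d)) :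
    ContinuousOn (wordIntegral x s w) (Set.Icc a b) := by
  induction w with
  | nil => exact continuousOn_const
  | cons i w ih =>
    have hab := hs.1.trans hs.2
    have h := (hx.intervalIntegrable_apply (Set.left_mem_Icc.2 hab)
      (Set.right_mem_Icc.2 hab) i).continuousOn_mul (by rwa [Set.uIcc_of_le hab])
    have := intervalIntegral.continuousOn_primitive_interval' h
      (a := s) (by rwa [Set.uIcc_of_le hab])
    rwa [Set.uIcc_of_le hab] at this

theorem IsLipschitzPath.intervalIntegrable_wordIntegral {s u v : ℝ} (hx : IsLipschitzPath x a b)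
    (hs : s ∈ Set.Icc a b) (hu : u ∈ Set.Icc a b) (hv : v ∈ Set.Icc a b) (w : List (Fin d))
    (i : Fin d) : IntervalIntegrable (fun r => wordIntegral x s w r * deriv x r i) volume u v :=
  (hx.intervalIntegrable_apply hu hv i).continuousOn_mul
    ((hx.continuousOn_wordIntegral hs w).mono (Set.uIcc_subset_Icc hu hv))

theorem IsLipschitzPath.abs_wordIntegral_le {s t : ℝ} (hx : IsLipschitzPath x s t) (hst : s ≤ t)
    (w : List (Fin d)) : |wordIntegral x s w t| ≤ pathLength x s t ^ w.length := by
  induction w generalizing t with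
  | nil => simp [wordIntegral]
  | cons i w ih =>
    rw [List.length_cons, pow_succ, ← Real.norm_eq_abs]
    simp only [wordIntegral, mul_comm _ (deriv x _ i)]
    refine hx.norm_integral_smul_le hst i (φ := wordIntegral x s w) fun r hr => ?_
    rw [Real.norm_eq_abs]
    exact (ih (hx.mono le_rfl hr.2) hr.1).trans
      (pow_le_pow_left₀ (pathLength_nonneg hr.1) (hx.pathLength_mono hr.1 hr.2) _)

theorem IsLipschitzPath.abs_signature_le {N : ℕ} {s t : ℝ} (hx : IsLipschitzPath x s t)
    (hst : s ≤ t) (k : Fin (N + 1)) (I : Fin (k : ℕ) → Fin d) :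
    |signature N x s t k I| ≤ pathLength x s t ^ (k : ℕ) := by
  rw [signature, iteratedIntegral_eq_wordIntegral]
  simpa [length_indexWord] using hx.abs_wordIntegral_le hst (indexWord k I)

/-- Chen's relation. -/
theorem IsLipschitzPath.wordIntegral_chen {s t u : ℝ} (hx : IsLipschitzPath x a b)
    (hs : s ∈ Set.Icc a b) (ht : t ∈ Set.Icc a b) (hu : u ∈ Set.Icc a b) (w : List (Fin d)) :
    wordIntegral x s w u = ∑ j ∈ Finset.range (w.length + 1),
      wordIntegral x t (w.take j) u * wordIntegral x s (w.drop j) t := by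
  induction w generalizing u with
  | nil => simp [wordIntegral]
  | cons i w ih =>
    rw [List.length_cons, Finset.sum_range_succ']
    simp only [List.take_succ_cons, List.drop_succ_cons, List.take_zero, List.drop_zero]
    -- Split the outermost integral at `t`: the part up to `t` is the term `j = 0`, and the
    -- inductive formula integrated over `[t, u]` gives the others.
    have e : wordIntegral x s (i :: w) u = wordIntegral x s (i :: w) t +
        ∫ r in t..u, wordIntegral x s w r * deriv x r i :=
      (intervalIntegral.integral_add_adjacent_intervals
        (hx.intervalIntegrable_wordIntegral hs hs ht w i)
        (hx.intervalIntegrable_wordIntegral hs ht hu w i)).symm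
    have e' : ∫ r in t..u, wordIntegral x s w r * deriv x r i =
        ∑ j ∈ Finset.range (w.length + 1),
          wordIntegral x t (i :: w.take j) u * wordIntegral x s (w.drop j) t := by
      have : ∫ r in t..u, wordIntegral x s w r * deriv x r i = ∫ r in t..u,
          ∑ j ∈ Finset.range (w.length + 1),
            (wordIntegral x t (w.take j) r * deriv x r i) * wordIntegral x s (w.drop j) t := by
        refine intervalIntegral.integral_congr fun r hr => ?_
        simp only [ih (Set.uIcc_subset_Icc ht hu hr), Finset.sum_mul]
        exact Finset.sum_congr rfl fun _ _ => by ring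
      rw [this, intervalIntegral.integral_finsetSum]
      · exact Finset.sum_congr rfl fun j _ => intervalIntegral.integral_mul_const _ _
      · exact fun j _ => (hx.intervalIntegrable_wordIntegral ht ht hu _ i).mul_const _
    rw [e, e', add_comm]
    simp [wordIntegral]

/-- Chen's relation expresses the signature over a union through those of the two pieces, and
subwords never exceed the truncation level. -/
theorem IsLipschitzPath.signature_eq_of_adjacent {N : ℕ} {z : ℝ → Euc d}
    {s t u s' t' u' : ℝ} (hx : IsLipschitzPath x s u) (hz : IsLipschitzPath z s' u')
    (hst : s ≤ t) (htu : t ≤ u) (hst' : s' ≤ t') (htu' : t' ≤ u')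
    (h1 : signature N x s t = signature N z s' t')
    (h2 : signature N x t u = signature N z t' u') :
    signature N x s u = signature N z s' u' := by
  rw [signature_eq_iff] at h1 h2 ⊢
  intro w hw
  rw [hx.wordIntegral_chen ⟨le_rfl, hst.trans htu⟩ ⟨hst, htu⟩ ⟨hst.trans htu, le_rfl⟩,
    hz.wordIntegral_chen ⟨le_rfl, hst'.trans htu'⟩ ⟨hst', htu'⟩ ⟨hst'.trans htu', le_rfl⟩]
  refine Finset.sum_congr rfl fun j _ => ?_
  rw [h1 _ (by rw [List.length_drop]; omega),
    h2 _ (by rw [List.length_take]; omega)]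

end Paths

/-! ### Concatenation and short paths with prescribed signature -/

section Concatenation

variable {d : ℕ}

/-- Only the derivative inside the interval matters, so neither the starting value nor the junction
point of a concatenation affects the integrals. -/
theorem wordIntegral_translate {x z : ℝ → Euc d} {s t c : ℝ} (hst : s ≤ t)
    (h : ∀ r ∈ Set.Ioo s t, deriv z (r + c) = deriv x r) (w : List (Fin d)) :
    wordIntegral z (s + c) w (t + c) = wordIntegral x s w t := by
  induction w generalizing t with
  | nil => rfl
  | cons i w ih =>
    rw [wordIntegral, wordIntegral,
      ← intervalIntegral.integral_comp_add_right (fun r => wordIntegral z (s + c) w r * deriv z r i)]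
    refine intervalIntegral.integral_congr_Ioo_of_le hst fun r hr => ?_
    simp only [h r hr, ih hr.1.le fun q hq => h q ⟨hq.1, hq.2.trans hr.2⟩]

theorem pathLength_translate {x z : ℝ → Euc d} {s t c : ℝ} (hst : s ≤ t)
    (h : ∀ r ∈ Set.Ioo s t, deriv z (r + c) = deriv x r) :
    pathLength z (s + c) (t + c) = pathLength x s t := by
  rw [pathLength, pathLength, ← intervalIntegral.integral_comp_add_right (fun r => ‖deriv z r‖)]
  exact intervalIntegral.integral_congr_Ioo_of_le hst fun r hr => by simp only [h r hr]

/-- The concatenation of two paths on `[0, 1]`, a path on `[0, 2]`. -/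
def concatPath (γ₁ γ₂ : ℝ → Euc d) (r : ℝ) : Euc d :=
  if r ≤ 1 then γ₁ r else γ₁ 1 + γ₂ (r - 1)

theorem deriv_concatPath_left (γ₁ γ₂ : ℝ → Euc d) {r : ℝ} (hr : r ∈ Set.Ioo (0 : ℝ) 1) :
    deriv (concatPath γ₁ γ₂) r = deriv γ₁ r := by
  refine Filter.EventuallyEq.deriv_eq ?_
  filter_upwards [Iio_mem_nhds hr.2] with q hq
  exact if_pos (le_of_lt hq)

theorem deriv_concatPath_right (γ₁ γ₂ : ℝ → Euc d) {r : ℝ} (hr : r ∈ Set.Ioo (0 : ℝ) 1) :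
    deriv (concatPath γ₁ γ₂) (r + 1) = deriv γ₂ r := by
  have : concatPath γ₁ γ₂ =ᶠ[nhds (r + 1)] fun q => γ₁ 1 + γ₂ (q - 1) := by
    filter_upwards [Ioi_mem_nhds (show (1 : ℝ) < r + 1 by linarith [hr.1])] with q hq
    exact if_neg (not_le.2 hq)
  rw [this.deriv_eq, deriv_const_add, deriv_comp_sub_const]
  simp

theorem IsLipschitzPath.concatPath {γ₁ γ₂ : ℝ → Euc d} (h₁ : IsLipschitzPath γ₁ 0 1)
    (h₂ : IsLipschitzPath γ₂ 0 1) (h0 : γ₂ 0 = 0) :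
    IsLipschitzPath (concatPath γ₁ γ₂) 0 2 := by
  obtain ⟨L₁, h₁⟩ := h₁
  obtain ⟨L₂, h₂⟩ := h₂
  have key : ∀ q r : ℝ, 0 ≤ q → q ≤ r → r ≤ 2 →
      dist (DavieEstimate.concatPath γ₁ γ₂ q) (DavieEstimate.concatPath γ₁ γ₂ r) ≤
        (L₁ + L₂ : ℝ≥0) * dist q r := by
    intro q r hq hqr hr
    rw [NNReal.coe_add, add_mul]
    have p1 : 0 ≤ (L₁ : ℝ) * dist q r := by positivity
    have p2 : 0 ≤ (L₂ : ℝ) * dist q r := by positivity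
    unfold DavieEstimate.concatPath
    split_ifs with hq1 hr1 hr1
    · linarith [h₁.dist_le_mul q ⟨hq, hq1⟩ r ⟨hq.trans hqr, hr1⟩]
    · have e1 := h₁.dist_le_mul q ⟨hq, hq1⟩ 1 ⟨zero_le_one, le_rfl⟩
      have e2 := h₂.dist_le_mul 0 ⟨le_rfl, zero_le_one⟩ (r - 1) ⟨by linarith, by linarith⟩
      have e3 : dist (γ₁ 1) (γ₁ 1 + γ₂ (r - 1)) = dist (γ₂ 0) (γ₂ (r - 1)) := by
        rw [h0, dist_self_add_right, dist_zero_left]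
      have e4 : dist q 1 ≤ dist q r := by
        rw [Real.dist_eq, Real.dist_eq, abs_of_nonpos (by linarith), abs_of_nonpos (by linarith)]
        linarith
      have e5 : dist 0 (r - 1) ≤ dist q r := by
        rw [Real.dist_eq, Real.dist_eq, abs_of_nonpos (by linarith), abs_of_nonpos (by linarith)]
        linarith
      calc _ ≤ dist (γ₁ q) (γ₁ 1) + dist (γ₁ 1) (γ₁ 1 + γ₂ (r - 1)) := dist_triangle _ _ _
        _ ≤ L₁ * dist q 1 + L₂ * dist 0 (r - 1) := by rw [e3]; exact add_le_add e1 e2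
        _ ≤ _ := by gcongr
    · exact absurd (hqr.trans hr1) hq1
    · rw [dist_add_left]
      have := h₂.dist_le_mul (q - 1) ⟨by linarith, by linarith⟩ (r - 1)
        ⟨by linarith, by linarith⟩
      rw [dist_sub_right] at this
      linarith
  refine ⟨L₁ + L₂, LipschitzOnWith.of_dist_le_mul fun q hq r hr => ?_⟩
  rcases le_total q r with h | h
  · exact key q r hq.1 h hr.2
  · rw [dist_comm, dist_comm q r]
    exact key r q hr.1 h hq.2

theorem signature_concatPath_left (N : ℕ) (γ₁ γ₂ : ℝ → Euc d) :
    signature N (concatPath γ₁ γ₂) 0 1 = signature N γ₁ 0 1 := by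
  refine signature_eq_iff.2 fun w _ => ?_
  simpa using wordIntegral_translate (c := 0) zero_le_one
    (fun r hr => by rw [add_zero]; exact deriv_concatPath_left γ₁ γ₂ hr) w

theorem signature_concatPath_right (N : ℕ) (γ₁ γ₂ : ℝ → Euc d) :
    signature N (concatPath γ₁ γ₂) 1 2 = signature N γ₂ 0 1 := by
  refine signature_eq_iff.2 fun w _ => ?_
  have := wordIntegral_translate (c := 1) zero_le_one
    (fun r hr => deriv_concatPath_right γ₁ γ₂ hr) w
  rwa [zero_add, one_add_one_eq_two] at this

theorem pathLength_concatPath_left (γ₁ γ₂ : ℝ → Euc d) :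
    pathLength (concatPath γ₁ γ₂) 0 1 = pathLength γ₁ 0 1 := by
  simpa using pathLength_translate (c := 0) zero_le_one
    (fun r hr => by rw [add_zero]; exact deriv_concatPath_left γ₁ γ₂ hr)

theorem pathLength_concatPath_right (γ₁ γ₂ : ℝ → Euc d) :
    pathLength (concatPath γ₁ γ₂) 1 2 = pathLength γ₂ 0 1 := by
  have := pathLength_translate (c := 1) zero_le_one
    (fun r hr => deriv_concatPath_right γ₁ γ₂ hr)
  rwa [zero_add, one_add_one_eq_two] at this

/-- A bound on the Hölder norm provides short paths with prescribed signature. -/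
theorem exists_path_of_holderNorm_le {N : ℕ} {p M s t : ℝ} {x : ℝ → Euc d}
    (hM : 0 < M) (h : holderNorm p (signature N x) ≤ ENNReal.ofReal M)
    (hs : 0 ≤ s) (hst : s < t) (ht : t ≤ 1) :
    ∃ γ : ℝ → Euc d, IsLipschitzPath γ 0 1 ∧ γ 0 = 0 ∧
      signature N γ 0 1 = signature N x s t ∧
      pathLength γ 0 1 ≤ 2 * M * (t - s) ^ (1 / p) := by
  have hpos : 0 < (t - s) ^ (1 / p) := Real.rpow_pos_of_pos (sub_pos.2 hst) _
  have h1 : ccNorm (signature N x s t) / ENNReal.ofReal ((t - s) ^ (1 / p)) ≤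
      ENNReal.ofReal M :=
    le_trans (le_iSup₂_of_le (f := fun s t => ⨆ (_ : 0 ≤ s ∧ s < t ∧ t ≤ 1),
      ccNorm (signature N x s t) / ENNReal.ofReal ((t - s) ^ (1 / p))) s t
      (le_iSup_of_le (show 0 ≤ s ∧ s < t ∧ t ≤ 1 from ⟨hs, hst, ht⟩) le_rfl)) h
  rw [ENNReal.div_le_iff (by simpa using hpos) ENNReal.ofReal_ne_top,
    ← ENNReal.ofReal_mul hM.le] at h1
  -- The factor 2 makes the inequality strict, so that a competitor exists without knowing that the
  -- infimum is attained.
  have h2 : ccNorm (signature N x s t) < ENNReal.ofReal (2 * M * (t - s) ^ (1 / p)) := by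
    refine h1.trans_lt ((ENNReal.ofReal_lt_ofReal_iff (by positivity)).2 ?_)
    nlinarith [mul_pos hM hpos]
  simp only [ccNorm, iInf_lt_iff] at h2
  obtain ⟨γ, hγ, hl⟩ := h2
  exact ⟨γ, hγ.1, hγ.2.1, hγ.2.2,
    ((ENNReal.ofReal_lt_ofReal_iff (by positivity)).1 hl).le⟩

end Concatenation

/-! ### Taylor expansion along solutions and the Euler error -/

section Euler

theorem intervalIntegrable_fun_sum {E ι : Type} [NormedAddCommGroup E] {s : Finset ι}
    {f : ι → ℝ → E} {a b : ℝ} (h : ∀ i ∈ s, IntervalIntegrable (f i) volume a b) :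
    IntervalIntegrable (fun r => ∑ i ∈ s, f i r) volume a b := by
  simpa only [Finset.sum_fn] using IntervalIntegrable.sum s h

/-- The chain rule for a Lipschitz curve given as a primitive. -/
theorem comp_eq_add_integral {E F : Type} [NormedAddCommGroup E] [NormedSpace ℝ E]
    [CompleteSpace E] [NormedAddCommGroup F] [NormedSpace ℝ F] [CompleteSpace F]
    {f : E → F} {y ψ : ℝ → E} {a b B : ℝ} {L : ℝ≥0} (hab : a ≤ b)
    (hψI : IntervalIntegrable ψ volume a b) (hψ : ∀ r ∈ Set.Ioo a b, ‖ψ r‖ ≤ B)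
    (hy : ∀ v ∈ Set.Icc a b, y v = y a + ∫ r in a..v, ψ r)
    (hf : Differentiable ℝ f) (hL : LipschitzWith L f)
    (hφI : IntervalIntegrable (fun r => fderiv ℝ f (y r) (ψ r)) volume a b) :
    f (y b) = f (y a) + ∫ r in a..b, fderiv ℝ f (y r) (ψ r) := by
  have primitive_lipschitz : ∀ {G : Type} [NormedAddCommGroup G] [NormedSpace ℝ G]
      {g : ℝ → G} {K : ℝ}, IntervalIntegrable g volume a b →
      (∀ r ∈ Set.Ioo a b, ‖g r‖ ≤ K) →
      LipschitzOnWith K.toNNReal (fun v => ∫ r in a..v, g r) (Set.Icc a b) := by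
    intro G _ _ g K hg hK
    refine LipschitzOnWith.of_dist_le_mul fun u hu v hv => ?_
    have hsub : ∀ w ∈ Set.Icc a b, IntervalIntegrable g volume a w := fun w hw => by
      refine hg.mono_set ?_
      rw [Set.uIcc_of_le hab]
      exact Set.uIcc_subset_Icc ⟨le_rfl, hab⟩ hw
    rw [dist_eq_norm, intervalIntegral.integral_interval_sub_left (hsub u hu) (hsub v hv)]
    refine (intervalIntegral.norm_integral_le_of_norm_le_const_ae (C := K) ?_).trans ?_
    · filter_upwards [volume.ae_ne b] with r hr hr'
      rw [Set.uIoc, Set.mem_Ioc] at hr'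
      exact hK r ⟨(le_min hv.1 hu.1).trans_lt hr'.1,
        lt_of_le_of_ne (hr'.2.trans (max_le hv.2 hu.2)) hr⟩
    · rw [Real.dist_eq]
      gcongr
      exact Real.le_coe_toNNReal _
  have hyL : LipschitzOnWith B.toNNReal y (Set.Icc a b) := fun u hu v hv => by
    rw [hy u hu, hy v hv, edist_add_left]
    exact primitive_lipschitz hψI hψ hu hv
  have hφ : ∀ r ∈ Set.Ioo a b, ‖fderiv ℝ f (y r) (ψ r)‖ ≤ L * B := fun r hr =>
    ((fderiv ℝ f (y r)).le_opNorm _).trans (mul_le_mul (norm_fderiv_le_of_lipschitz ℝ hL)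
      (hψ r hr) (norm_nonneg _) L.2)
  -- The difference of the two sides is absolutely continuous with derivative zero almost
  -- everywhere, hence constant.
  have hac : AbsolutelyContinuousOnInterval
      (fun v => f (y v) - ∫ r in a..v, fderiv ℝ f (y r) (ψ r)) a b := by
    refine AbsolutelyContinuousOnInterval.sub
      (f := fun v => f (y v)) (g := fun v => ∫ r in a..v, fderiv ℝ f (y r) (ψ r)) ?_ ?_
    · refine LipschitzOnWith.absolutelyContinuousOnInterval (K := L * B.toNNReal) ?_
      rw [Set.uIcc_of_le hab]
      exact hL.comp_lipschitzOnWith hyL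
    · refine LipschitzOnWith.absolutelyContinuousOnInterval (K := (L * B).toNNReal) ?_
      rw [Set.uIcc_of_le hab]
      exact primitive_lipschitz hφI hφ
  obtain ⟨c, hc⟩ := hac.const_of_ae_hasDerivAt_zero (by
    filter_upwards [hψI.ae_hasDerivAt_integral, hφI.ae_hasDerivAt_integral, volume.ae_ne a,
      volume.ae_ne b] with r h1 h2 hra hrb hr
    have hr' := hr
    rw [Set.uIcc_of_le hab] at hr'
    have hy' : HasDerivAt y (ψ r) r := by
      refine ((h1 hr a Set.left_mem_uIcc).const_add (y a)).congr_of_eventuallyEq ?_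
      filter_upwards [Icc_mem_nhds (lt_of_le_of_ne hr'.1 (Ne.symm hra))
        (lt_of_le_of_ne hr'.2 hrb)] with v hv using hy v hv
    have h := ((hf (y r)).hasFDerivAt.comp_hasDerivAt r hy').sub (h2 hr a Set.left_mem_uIcc)
    rwa [sub_self] at h)
  have ha := hc a Set.left_mem_uIcc
  have hb := hc b Set.right_mem_uIcc
  simp only [intervalIntegral.integral_same, sub_zero] at ha
  rw [ha, ← hb]
  abel

variable {d e : ℕ} {V : Fin d → Euc e → Euc e} {x : ℝ → Euc d} {y : ℝ → Euc e} {a b : ℝ}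
  {y₀ : Euc e}

theorem IsSolution.apply_left (hy : IsSolution V x a b y₀ y) (hab : a ≤ b) : y a = y₀ := by
  have := hy.2 a ⟨le_rfl, hab⟩
  simpa using this

theorem IsSolution.intervalIntegrable (hx : IsLipschitzPath x a b)
    (hy : IsSolution V x a b y₀ y) {W : Euc e → Euc e} (hW : Continuous W) (i : Fin d)
    {s t : ℝ} (hs : s ∈ Set.Icc a b) (ht : t ∈ Set.Icc a b) :
    IntervalIntegrable (fun r => deriv x r i • W (y r)) volume s t :=
  hx.intervalIntegrable_smul hs ht i (hW.comp_continuousOn hy.1)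

theorem IsSolution.restrict (hx : IsLipschitzPath x a b) (hV : ∀ i, Continuous (V i))
    (hy : IsSolution V x a b y₀ y) {s t : ℝ} (hs : a ≤ s) (hst : s ≤ t) (ht : t ≤ b) :
    IsSolution V x s t (y s) y := by
  have hs' : s ∈ Set.Icc a b := ⟨hs, hst.trans ht⟩
  refine ⟨hy.1.mono (Set.Icc_subset_Icc hs ht), fun r hr => ?_⟩
  have hr' : r ∈ Set.Icc a b := ⟨hs.trans hr.1, hr.2.trans ht⟩
  rw [hy.2 r hr', hy.2 s hs', add_assoc, ← Finset.sum_add_distrib]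
  congr 1
  refine Finset.sum_congr rfl fun i _ => ?_
  exact (intervalIntegral.integral_add_adjacent_intervals
    (hy.intervalIntegrable hx (hV i) i ⟨le_rfl, hs.trans hs'.2⟩ hs')
    (hy.intervalIntegrable hx (hV i) i hs' hr')).symm

theorem IsSolution.norm_sub_le (hx : IsLipschitzPath x a b) (hab : a ≤ b)
    (hy : IsSolution V x a b y₀ y) {B : Fin d → ℝ} (hB : ∀ i η, ‖V i η‖ ≤ B i) :
    ‖y b - y a‖ ≤ (∑ i, B i) * pathLength x a b := by
  rw [hy.2 b ⟨hab, le_rfl⟩, hy.apply_left hab, add_sub_cancel_left, Finset.sum_mul]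
  exact norm_sum_le_of_le _ fun i _ => hx.norm_integral_smul_le hab i fun r _ => hB i _

theorem IsSolution.comp_eq (hx : IsLipschitzPath x a b) (hab : a ≤ b)
    (hV : ∀ i, IsLipReg 0 (V i)) (hy : IsSolution V x a b y₀ y) {n : ℕ} {f : Euc e → Euc e}
    (hf : IsLipReg (n + 1) f) :
    f (y b) = f (y a) + ∑ i, ∫ r in a..b, deriv x r i • lieDeriv (V i) f (y r) := by
  obtain ⟨K, hK0, hK⟩ := hx.exists_norm_deriv_le
  choose B hB using fun i => (hV i).bounded
  have hVc : ∀ i, Continuous (V i) := fun i => (hV i).lipschitz.choose_spec.continuous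
  have hlie : ∀ i, Continuous (lieDeriv (V i) f) := fun i =>
    (IsLipReg.lieDeriv (hf.of_le (Nat.succ_le_succ n.zero_le)) (hV i)).lipschitz.choose_spec.continuous
  have hma : a ∈ Set.Icc a b := ⟨le_rfl, hab⟩
  have hmb : b ∈ Set.Icc a b := ⟨hab, le_rfl⟩
  obtain ⟨L, hL⟩ := hf.lipschitz
  have e : ∀ r, fderiv ℝ f (y r) (∑ i, deriv x r i • V i (y r)) =
      ∑ i, deriv x r i • lieDeriv (V i) f (y r) := fun r => by
    simp only [map_sum, map_smul, lieDeriv]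
  have key := comp_eq_add_integral (f := f) (y := y) (ψ := fun r => ∑ i, deriv x r i • V i (y r))
    (a := a) (b := b) (B := ∑ i, K * B i) (L := L) hab ?_ ?_ ?_ hf.2.1 hL ?_
  · rw [key]
    simp only [e]
    rw [intervalIntegral.integral_finsetSum]
    exact fun i _ => hy.intervalIntegrable hx (hlie i) i hma hmb
  · exact intervalIntegrable_fun_sum fun i _ => hy.intervalIntegrable hx (hVc i) i hma hmb
  · intro r hr
    refine norm_sum_le_of_le _ fun i _ => ?_
    rw [norm_smul]
    exact mul_le_mul ((PiLp.norm_apply_le _ _).trans (hK r hr)) (hB i _) (norm_nonneg _) hK0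
  · intro v hv
    rw [hy.2 v hv, hy.apply_left hab, intervalIntegral.integral_finsetSum]
    exact fun i _ => hy.intervalIntegrable hx (hVc i) i hma hv
  · simp only [e]
    exact intervalIntegrable_fun_sum fun i _ => hy.intervalIntegrable hx (hlie i) i hma hmb

/-- `V_{i_1} ⋯ V_{i_k} f`. -/
def iteratedLieDerivOf (V : Fin d → Euc e → Euc e) (f : Euc e → Euc e) :
    (k : ℕ) → (Fin k → Fin d) → Euc e → Euc e
  | 0, _ => f
  | k + 1, I => lieDeriv (V (I 0)) (iteratedLieDerivOf V f k (Fin.tail I))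

/-- Peels off the operator that acts first. Its index is the last letter, which is also the
outermost variable of the iterated integral. -/
theorem iteratedLieDerivOf_succ (V : Fin d → Euc e → Euc e) (f : Euc e → Euc e) (k : ℕ)
    (I : Fin (k + 1) → Fin d) : iteratedLieDerivOf V f (k + 1) I =
      iteratedLieDerivOf V (lieDeriv (V (I (Fin.last k))) f) k (Fin.init I) := by
  induction k with
  | zero => rfl
  | succ k ih =>
    rw [iteratedLieDerivOf, ih, iteratedLieDerivOf, Fin.tail_init_eq_init_tail]
    rfl

theorem iteratedLieDerivOf_id (V : Fin d → Euc e → Euc e) (k : ℕ) (I : Fin k → Fin d) :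
    iteratedLieDerivOf V id k I = iteratedLieDeriv V k I := by
  induction k with
  | zero => rfl
  | succ k ih => rw [iteratedLieDerivOf, iteratedLieDeriv, ih]

/-- The stochastic Taylor polynomial of order `m` of `f` along the flow of `dy = V(y) dx`. -/
def lieTaylor (V : Fin d → Euc e → Euc e) (x : ℝ → Euc d) (s : ℝ) (η : Euc e) (m : ℕ)
    (f : Euc e → Euc e) (t : ℝ) : Euc e :=
  ∑ k ∈ Finset.range (m + 1), ∑ I : Fin k → Fin d,
    iteratedIntegral x s k I t • iteratedLieDerivOf V f k I η

theorem IsLipschitzPath.continuousOn_iteratedIntegral {s : ℝ} (hx : IsLipschitzPath x a b)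
    (hs : s ∈ Set.Icc a b) (k : ℕ) (I : Fin k → Fin d) :
    ContinuousOn (iteratedIntegral x s k I) (Set.Icc a b) :=
  (hx.continuousOn_wordIntegral hs (indexWord k I)).congr
    fun t _ => iteratedIntegral_eq_wordIntegral x s k I t

theorem IsLipschitzPath.continuousOn_lieTaylor (hx : IsLipschitzPath x a b) (hab : a ≤ b)
    (η : Euc e) (m : ℕ) (f : Euc e → Euc e) :
    ContinuousOn (lieTaylor V x a η m f) (Set.Icc a b) :=
  continuousOn_finsetSum _ fun k _ => continuousOn_finsetSum _ fun I _ =>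
    (hx.continuousOn_iteratedIntegral ⟨le_rfl, hab⟩ k I).smul continuousOn_const

theorem lieTaylor_zero (V : Fin d → Euc e → Euc e) (x : ℝ → Euc d) (s : ℝ) (η : Euc e)
    (f : Euc e → Euc e) (t : ℝ) : lieTaylor V x s η 0 f t = f η := by
  simp [lieTaylor, iteratedIntegral, iteratedLieDerivOf]

/-- The Taylor polynomial obeys the recursion that `f (y b)` obeys by the chain rule, with the
truncation order lowered by one under the integral. -/
theorem IsLipschitzPath.lieTaylor_succ (hx : IsLipschitzPath x a b) (hab : a ≤ b)
    (η : Euc e) (m : ℕ) (f : Euc e → Euc e) :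
    lieTaylor V x a η (m + 1) f b = f η + ∑ i, ∫ r in a..b,
      deriv x r i • lieTaylor V x a η m (lieDeriv (V i) f) r := by
  have hma : a ∈ Set.Icc a b := ⟨le_rfl, hab⟩
  have hmb : b ∈ Set.Icc a b := ⟨hab, le_rfl⟩
  have e1 : ∀ i, ∫ r in a..b, deriv x r i • lieTaylor V x a η m (lieDeriv (V i) f) r =
      ∑ k ∈ Finset.range (m + 1), ∑ I : Fin k → Fin d,
        (∫ r in a..b, iteratedIntegral x a k I r * deriv x r i) •
          iteratedLieDerivOf V (lieDeriv (V i) f) k I η := by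
    intro i
    have hI : ∀ (k : ℕ) (I : Fin k → Fin d), IntervalIntegrable
        (fun r => (iteratedIntegral x a k I r * deriv x r i) •
          iteratedLieDerivOf V (lieDeriv (V i) f) k I η) volume a b := fun k I => by
      simp only [iteratedIntegral_eq_wordIntegral]
      have h := hx.intervalIntegrable_wordIntegral hma hma hmb (indexWord k I) i
      exact ⟨h.1.smul_const _, h.2.smul_const _⟩
    have : ∀ r, deriv x r i • lieTaylor V x a η m (lieDeriv (V i) f) r =
        ∑ k ∈ Finset.range (m + 1), ∑ I : Fin k → Fin d,
          (iteratedIntegral x a k I r * deriv x r i) •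
            iteratedLieDerivOf V (lieDeriv (V i) f) k I η := fun r => by
      simp only [lieTaylor, Finset.smul_sum, smul_smul, mul_comm]
    simp only [this]
    rw [intervalIntegral.integral_finsetSum
      fun k _ => intervalIntegrable_fun_sum fun I _ => hI k I]
    refine Finset.sum_congr rfl fun k _ => ?_
    rw [intervalIntegral.integral_finsetSum fun I _ => hI k I]
    exact Finset.sum_congr rfl fun I _ => intervalIntegral.integral_smul_const _ _
  simp only [e1]
  rw [lieTaylor, Finset.sum_range_succ', Finset.sum_comm, add_comm]
  congr 1
  · simp [iteratedIntegral, iteratedLieDerivOf]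
  · refine Finset.sum_congr rfl fun k _ => ?_
    rw [← (Fin.snocEquiv fun _ => Fin d).sum_comp, Fintype.sum_prod_type]
    refine Finset.sum_congr rfl fun i _ => Finset.sum_congr rfl fun I _ => ?_
    have e2 : Fin.snocEquiv (fun _ : Fin (k + 1) => Fin d) (i, I) =
        Fin.snoc (α := fun _ => Fin d) I i := rfl
    rw [iteratedLieDerivOf_succ, e2, Fin.init_snoc, Fin.snoc_last, iteratedIntegral]
    simp only [Fin.init_snoc, Fin.snoc_last]

theorem eulerIncrement_eq_lieTaylor (V : Fin d → Euc e → Euc e) (x : ℝ → Euc d) (s t : ℝ)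
    (η : Euc e) (N : ℕ) :
    eulerIncrement V η (signature N x s t) = lieTaylor V x s η N id t - η := by
  have h := Fin.sum_univ_eq_sum_range (fun k => if k = 0 then (0 : Euc e) else
      ∑ I : Fin k → Fin d, iteratedIntegral x s k I t • iteratedLieDeriv V k I η) (N + 1)
  rw [eulerIncrement, lieTaylor]
  refine h.trans ?_
  rw [Finset.sum_range_succ', Finset.sum_range_succ']
  simp [iteratedIntegral, iteratedLieDerivOf, iteratedLieDerivOf_id]
  rfl

/-- Subtracting the two recursions gains one power of the length. The chain rule is an assumption
here so that the identity, which is not bounded, is also a possible `f`. -/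
theorem IsLipschitzPath.norm_comp_sub_lieTaylor_succ_le (hx : IsLipschitzPath x a b)
    (hab : a ≤ b) (hyc : ContinuousOn y (Set.Icc a b)) {f : Euc e → Euc e}
    (hfc : ∀ i, Continuous (lieDeriv (V i) f))
    (hf : f (y b) = f (y a) + ∑ i, ∫ r in a..b, deriv x r i • lieDeriv (V i) f (y r))
    {m : ℕ} {C : Fin d → ℝ}
    (hC : ∀ i, ∀ r ∈ Set.Icc a b, ‖lieDeriv (V i) f (y r) -
      lieTaylor V x a (y a) m (lieDeriv (V i) f) r‖ ≤ C i * pathLength x a b ^ (m + 1)) :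
    ‖f (y b) - lieTaylor V x a (y a) (m + 1) f b‖ ≤
      (∑ i, C i) * pathLength x a b ^ (m + 2) := by
  have hma : a ∈ Set.Icc a b := ⟨le_rfl, hab⟩
  have hmb : b ∈ Set.Icc a b := ⟨hab, le_rfl⟩
  rw [hx.lieTaylor_succ hab, hf, add_sub_add_left_eq_sub, ← Finset.sum_sub_distrib,
    Finset.sum_mul]
  refine norm_sum_le_of_le _ fun i _ => ?_
  rw [← intervalIntegral.integral_sub
    (hx.intervalIntegrable_smul hma hmb i (φ := fun r => lieDeriv (V i) f (y r))
      ((hfc i).comp_continuousOn hyc))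
    (hx.intervalIntegrable_smul hma hmb i (hx.continuousOn_lieTaylor hab _ _ _))]
  simp only [← smul_sub]
  refine (hx.norm_integral_smul_le hab i (hC i)).trans (le_of_eq ?_)
  ring

theorem exists_norm_comp_sub_lieTaylor_le (m : ℕ) (hV : ∀ i, IsLipReg m (V i))
    {f : Euc e → Euc e} (hf : IsLipReg m f) :
    ∃ C : ℝ, 0 ≤ C ∧ ∀ (x : ℝ → Euc d) (y : ℝ → Euc e) (a b : ℝ), a ≤ b →
      IsLipschitzPath x a b → IsSolution V x a b (y a) y →
      ‖f (y b) - lieTaylor V x a (y a) m f b‖ ≤ C * pathLength x a b ^ (m + 1) := by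
  induction m generalizing f with
  | zero =>
    choose B hB using fun i => (hV i).bounded
    obtain ⟨L, hL⟩ := hf.lipschitz
    refine ⟨L * |∑ i, B i|, by positivity, fun x y a b hab hx hy => ?_⟩
    rw [lieTaylor_zero, zero_add, pow_one, mul_assoc]
    refine (hL.norm_sub_le _ _).trans (mul_le_mul_of_nonneg_left ?_ L.2)
    exact (hy.norm_sub_le hx hab hB).trans
      (mul_le_mul_of_nonneg_right (le_abs_self _) (pathLength_nonneg hab))
  | succ m ih =>
    have hlie : ∀ i, IsLipReg m (lieDeriv (V i) f) := fun i => hf.lieDeriv (hV i).of_succ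
    choose C hC0 hC using fun i => ih (fun i => (hV i).of_succ) (hlie i)
    refine ⟨∑ i, C i, Finset.sum_nonneg fun i _ => hC0 i, fun x y a b hab hx hy => ?_⟩
    have hV0 : ∀ i, IsLipReg 0 (V i) := fun i => (hV i).of_le (Nat.zero_le _)
    refine hx.norm_comp_sub_lieTaylor_succ_le hab hy.1
      (fun i => (hlie i).lipschitz.choose_spec.continuous) (hy.comp_eq hx hab hV0 hf)
      fun i r hr => ?_
    have hy' := hy.restrict hx (fun i => (hV0 i).lipschitz.choose_spec.continuous)
      le_rfl hr.1 hr.2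
    refine (hC i x y a r hr.1 (hx.mono le_rfl hr.2) hy').trans ?_
    exact mul_le_mul_of_nonneg_left (pow_le_pow_left₀ (pathLength_nonneg hr.1)
      (hx.pathLength_mono hr.1 hr.2) _) (hC0 i)

/-- The error of the step-`N` Euler scheme along a Lipschitz path. -/
theorem exists_norm_sub_eulerIncrement_le {N : ℕ} (hN : 1 ≤ N)
    (hV : ∀ i, IsLipReg (N - 1) (V i)) :
    ∃ C : ℝ, 0 ≤ C ∧ ∀ (x : ℝ → Euc d) (y₀ : Euc e) (y : ℝ → Euc e) (a b : ℝ),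
      IsLipschitzPath x a b → IsSolution V x a b y₀ y → ∀ s t, a ≤ s → s ≤ t → t ≤ b →
      ‖y t - y s - eulerIncrement V (y s) (signature N x s t)‖ ≤
        C * pathLength x s t ^ (N + 1) := by
  obtain ⟨m, rfl⟩ : ∃ m, N = m + 1 := ⟨N - 1, by omega⟩
  rw [Nat.add_sub_cancel] at hV
  choose C hC0 hC using fun i => exists_norm_comp_sub_lieTaylor_le m hV (hV i)
  have hVc : ∀ i, Continuous (V i) := fun i => (hV i).lipschitz.choose_spec.continuous
  refine ⟨∑ i, C i, Finset.sum_nonneg fun i _ => hC0 i,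
    fun x y₀ y a b hx hy s t hs hst ht => ?_⟩
  have hy' := hy.restrict hx hVc hs hst ht
  have hx' := hx.mono hs ht
  rw [eulerIncrement_eq_lieTaylor, sub_sub_sub_cancel_right]
  -- For the identity the chain rule is the equation itself; the remaining orders come from
  -- expanding each `V i`, which has the required `N - 1` derivatives.
  refine hx'.norm_comp_sub_lieTaylor_succ_le (f := id) hst hy'.1
    (fun i => by rw [lieDeriv_id]; exact hVc i) ?_ fun i r hr => ?_
  · simp only [lieDeriv_id]
    exact hy'.2 t ⟨hst, le_rfl⟩
  · rw [lieDeriv_id]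
    refine (hC i x y s r hr.1 (hx'.mono le_rfl hr.2)
      (hy'.restrict hx' hVc le_rfl hr.1 hr.2)).trans ?_
    exact mul_le_mul_of_nonneg_left (pow_le_pow_left₀ (pathLength_nonneg hr.1)
      (hx'.pathLength_mono hr.1 hr.2) _) (hC0 i)

end Euler

/-! ### Existence of solutions along short paths -/

section Existence

variable {d e : ℕ} {V : Fin d → Euc e → Euc e} {x : ℝ → Euc d} {a b : ℝ}

/-- The Picard map, whose fixed points are the solutions of `dy = V(y) dx`. -/
def picardMap (V : Fin d → Euc e → Euc e) (hV : ∀ i, Continuous (V i)) (hab : a ≤ b)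
    (hx : IsLipschitzPath x a b) (η : Euc e) (w : C(Set.Icc a b, Euc e)) :
    C(Set.Icc a b, Euc e) where
  toFun t := η + ∑ i, ∫ r in a..t, deriv x r i • V i (Set.IccExtend hab w r)
  continuous_toFun := by
    refine continuous_const.add (continuous_finsetSum _ fun i _ => ?_)
    have h := hx.intervalIntegrable_smul (Set.left_mem_Icc.2 hab) (Set.right_mem_Icc.2 hab) i
      (φ := fun r => V i (Set.IccExtend hab w r))
      ((hV i).comp (w.continuous.Icc_extend' )).continuousOn
    have h' := intervalIntegral.continuousOn_primitive_interval' h Set.left_mem_uIcc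
    rw [Set.uIcc_of_le hab] at h'
    exact continuousOn_iff_continuous_domRestrict.1 h'

/-- The sum of the Lipschitz constants times the length is at most `1 / 2`, so the map contracts in
the sup norm on the whole interval and no patching is needed. -/
theorem contractingWith_picardMap (hab : a ≤ b) (hx : IsLipschitzPath x a b)
    {L : Fin d → ℝ≥0} (hV : ∀ i, Continuous (V i)) (hL : ∀ i, LipschitzWith (L i) (V i))
    (hsmall : (∑ i, (L i : ℝ)) * pathLength x a b ≤ 1 / 2) (η : Euc e) :
    ContractingWith (1 / 2) (picardMap V hV hab hx η) := by
  refine ⟨by norm_num, LipschitzWith.of_dist_le_mul fun w w' => ?_⟩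
  rw [ContinuousMap.dist_le (by positivity)]
  intro t
  have hma : a ∈ Set.Icc a b := ⟨le_rfl, hab⟩
  have hI : ∀ (u : C(Set.Icc a b, Euc e)) i, IntervalIntegrable
      (fun r => deriv x r i • V i (Set.IccExtend hab u r)) volume a t := fun u i =>
    hx.intervalIntegrable_smul hma t.2 i (φ := fun r => V i (Set.IccExtend hab u r))
      ((hV i).comp (u.continuous.Icc_extend')).continuousOn
  have e1 : dist (picardMap V hV hab hx η w t) (picardMap V hV hab hx η w' t) =
      ‖∑ i, ∫ r in a..t, deriv x r i •
        (V i (Set.IccExtend hab w r) - V i (Set.IccExtend hab w' r))‖ := by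
    rw [dist_eq_norm]
    simp only [picardMap, ContinuousMap.coe_mk, add_sub_add_left_eq_sub,
      ← Finset.sum_sub_distrib]
    congr 1
    refine Finset.sum_congr rfl fun i _ => ?_
    rw [← intervalIntegral.integral_sub (hI w i) (hI w' i)]
    simp only [smul_sub]
  have e2 : ∀ i ∈ Finset.univ, ‖∫ r in a..t, deriv x r i •
      (V i (Set.IccExtend hab w r) - V i (Set.IccExtend hab w' r))‖ ≤
        L i * dist w w' * pathLength x a b := fun i _ => by
    refine ((hx.mono le_rfl t.2.2).norm_integral_smul_le t.2.1 i
      (B := L i * dist w w') fun r _ => ?_).trans ?_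
    · rw [← dist_eq_norm]
      refine ((hL i).dist_le_mul _ _).trans (mul_le_mul_of_nonneg_left ?_ (L i).2)
      exact ContinuousMap.dist_apply_le_dist _
    · exact mul_le_mul_of_nonneg_left (hx.pathLength_mono t.2.1 t.2.2) (by positivity)
  rw [e1]
  refine (norm_sum_le_of_le _ e2).trans ?_
  calc ∑ i, L i * dist w w' * pathLength x a b
      = ((∑ i, (L i : ℝ)) * pathLength x a b) * dist w w' := by
        rw [Finset.sum_mul, Finset.sum_mul]
        exact Finset.sum_congr rfl fun i _ => by ring
    _ ≤ 1 / 2 * dist w w' := mul_le_mul_of_nonneg_right hsmall dist_nonneg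
    _ = _ := by simp

theorem exists_isSolution (hab : a ≤ b) (hx : IsLipschitzPath x a b)
    {L : Fin d → ℝ≥0} (hL : ∀ i, LipschitzWith (L i) (V i))
    (hsmall : (∑ i, (L i : ℝ)) * pathLength x a b ≤ 1 / 2) (η : Euc e) :
    ∃ w, IsSolution V x a b η w := by
  have hV : ∀ i, Continuous (V i) := fun i => (hL i).continuous
  have hc := contractingWith_picardMap hab hx hV hL hsmall η
  set w := hc.fixedPoint with hw
  have hfix : picardMap V hV hab hx η w = w := hc.fixedPoint_isFixedPt
  refine ⟨Set.IccExtend hab w, w.continuous.Icc_extend'.continuousOn, fun t ht => ?_⟩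
  rw [Set.IccExtend_of_mem hab _ ht]
  exact (congrArg (fun u : C(Set.Icc a b, Euc e) => u ⟨t, ht⟩) hfix).symm

end Existence

/-! ### The Euler defect on short intervals -/

section LocalEstimate

variable {d e N : ℕ} {V : Fin d → Euc e → Euc e} {x : ℝ → Euc d} {y : ℝ → Euc e}
  {y₀ : Euc e} {p M : ℝ}

/-- Level 0 is excluded from the bound on `g`: the scheme omits it, and for a signature its entry is
1, hence not small. -/
theorem exists_eulerIncrement_bounds (hN : 1 ≤ N) (hV : ∀ i, IsLipReg (N - 1) (V i)) :
    ∃ A : ℝ, 0 ≤ A ∧ ∀ (g : TruncTensor d N) (σ : ℝ),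
      (∀ (k : Fin (N + 1)) (I : Fin (k : ℕ) → Fin d), (k : ℕ) ≠ 0 → |g k I| ≤ σ) →
      (∀ η, ‖eulerIncrement V η g‖ ≤ A * σ) ∧
      ∀ η η', ‖eulerIncrement V η g - eulerIncrement V η' g‖ ≤ A * σ * ‖η - η'‖ := by
  have hB : ∀ (k : Fin (N + 1)) (I : Fin (k : ℕ) → Fin d), ∃ B : ℝ, 0 ≤ B ∧ ((k : ℕ) ≠ 0 →
      (∀ η, ‖iteratedLieDeriv V k I η‖ ≤ B) ∧
      ∀ η η', ‖iteratedLieDeriv V k I η - iteratedLieDeriv V k I η'‖ ≤ B * ‖η - η'‖) := by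
    rintro ⟨k, hk⟩ I
    cases k with
    | zero => exact ⟨0, le_rfl, fun h => absurd rfl h⟩
    | succ k =>
      have h := isLipReg_iteratedLieDeriv hV k (by omega) I
      obtain ⟨B, hB⟩ := h.bounded
      obtain ⟨L, hL⟩ := h.lipschitz
      refine ⟨max B L, le_max_of_le_right L.2, fun _ =>
        ⟨fun η => (hB η).trans (le_max_left _ _), fun η η' => ?_⟩⟩
      exact (hL.norm_sub_le _ _).trans
        (mul_le_mul_of_nonneg_right (le_max_right _ _) (norm_nonneg _))
  choose B hB0 hB using hB
  refine ⟨∑ k : Fin (N + 1), if (k : ℕ) = 0 then 0 else ∑ I, B k I,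
    Finset.sum_nonneg fun k _ => ?_, fun g σ hg => ⟨fun η => ?_, fun η η' => ?_⟩⟩
  · split_ifs
    exacts [le_rfl, Finset.sum_nonneg fun I _ => hB0 k I]
  · rw [eulerIncrement, Finset.sum_mul]
    refine norm_sum_le_of_le _ fun k _ => ?_
    split_ifs with hk
    · simp
    · rw [Finset.sum_mul]
      refine norm_sum_le_of_le _ fun I _ => ?_
      rw [norm_smul, mul_comm, Real.norm_eq_abs]
      exact mul_le_mul ((hB k I hk).1 η) (hg k I hk) (abs_nonneg _) (hB0 k I)
  · rw [eulerIncrement, eulerIncrement, ← Finset.sum_sub_distrib, Finset.sum_mul, Finset.sum_mul]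
    refine norm_sum_le_of_le _ fun k _ => ?_
    split_ifs with hk
    · simp
    · rw [← Finset.sum_sub_distrib, Finset.sum_mul, Finset.sum_mul]
      refine norm_sum_le_of_le _ fun I _ => ?_
      rw [← smul_sub, norm_smul, Real.norm_eq_abs]
      calc |g k I| * ‖iteratedLieDeriv V k I η - iteratedLieDeriv V k I η'‖
          ≤ σ * (B k I * ‖η - η'‖) :=
            mul_le_mul (hg k I hk) ((hB k I hk).2 η η') (norm_nonneg _)
              ((abs_nonneg _).trans (hg k I hk))
        _ = _ := by ring

theorem IsLipschitzPath.abs_signature_le_of_le_one {a b σ : ℝ} (hx : IsLipschitzPath x a b)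
    (hab : a ≤ b) (hσ : pathLength x a b ≤ σ) (hσ1 : σ ≤ 1) (k : Fin (N + 1))
    (I : Fin (k : ℕ) → Fin d) (hk : (k : ℕ) ≠ 0) : |signature N x a b k I| ≤ σ := by
  have h0 := pathLength_nonneg (x := x) hab
  exact (hx.abs_signature_le hab k I).trans
    ((pow_le_of_le_one h0 (hσ.trans hσ1) hk).trans hσ)

/-- The local error of the step-`N` Euler scheme on `[s, t]`. -/
def eulerDefect (V : Fin d → Euc e → Euc e) (N : ℕ) (x : ℝ → Euc d) (y : ℝ → Euc e)
    (s t : ℝ) : Euc e :=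
  y t - y s - eulerIncrement V (y s) (signature N x s t)

/-- `x` is a Lipschitz path over `[0, 1]` whose lift has Hölder norm at most `M`, and `y` solves
`dy = V(y) dx`. -/
structure IsControlled (V : Fin d → Euc e → Euc e) (N : ℕ) (p M : ℝ) (x : ℝ → Euc d)
    (y : ℝ → Euc e) : Prop where
  one_le : 1 ≤ M
  path : IsLipschitzPath x 0 1
  holder : holderNorm p (signature N x) ≤ ENNReal.ofReal M
  solution : IsSolution V x 0 1 (y 0) y

/-- The Euler defect is almost additive over short adjacent intervals. -/
theorem exists_norm_eulerDefect_le_add (hp : 1 ≤ p) (hN : 1 ≤ N)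
    (hV : ∀ i, IsLipReg (N - 1) (V i)) :
    ∃ C ρ₀ : ℝ, 0 ≤ C ∧ 0 < ρ₀ ∧ ρ₀ ≤ 1 / 4 ∧ ∀ (M : ℝ) (x : ℝ → Euc d) (y : ℝ → Euc e),
      IsControlled V N p M x y → ∀ s t u ρ : ℝ, 0 ≤ s → s < t → t < u → u ≤ 1 →
      ρ = M * (u - s) ^ (1 / p) → ρ ≤ ρ₀ →
      ‖eulerDefect V N x y s u‖ ≤ (1 + C * ρ) * ‖eulerDefect V N x y s t‖ +
        ‖eulerDefect V N x y t u‖ + C * ρ ^ (N + 1) := by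
  obtain ⟨A, hA0, hA⟩ := exists_eulerIncrement_bounds hN hV
  obtain ⟨E, hE0, hE⟩ := exists_norm_sub_eulerIncrement_le hN hV
  choose L hL using fun i => (hV i).lipschitz
  have hΛ0 : 0 ≤ ∑ i, (L i : ℝ) := Finset.sum_nonneg fun i _ => (L i).2
  set Λ := ∑ i, (L i : ℝ) with hΛ
  -- The term `4 * A` comes from the Lipschitz bound on the increment, the rest from three Euler
  -- errors `ε` and one more multiplied by `4 * A * ρ`. The cutoff gives `4 * ρ ≤ 1`, so powers of
  -- the length are at most `4 * ρ`, and the Picard condition `Λ * (4 * ρ) ≤ 1 / 2`.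
  refine ⟨4 * A + (3 + 4 * A) * (E * 4 ^ (N + 1)), min (1 / 4) (1 / (8 * (Λ + 1))),
    by positivity, by positivity, min_le_left _ _, ?_⟩
  intro M x y hc s t u ρ hs hst htu hu hρ hρ₀
  have hM : 0 < M := one_pos.trans_le hc.one_le
  have hρ4 : ρ ≤ 1 / 4 := hρ₀.trans (min_le_left _ _)
  have hρΛ : ρ * (8 * (Λ + 1)) ≤ 1 := by
    rw [← le_div_iff₀ (by positivity)]
    exact hρ₀.trans (min_le_right _ _)
  have hρ0 : 0 ≤ ρ := hρ ▸ mul_nonneg hM.le (Real.rpow_nonneg (by linarith) _)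
  have hlen : ∀ v w, s ≤ v → v < w → w ≤ u → 2 * M * (w - v) ^ (1 / p) ≤ 2 * ρ := by
    intro v w hv hvw hw
    rw [hρ, mul_assoc]
    have : (w - v) ^ (1 / p) ≤ (u - s) ^ (1 / p) :=
      Real.rpow_le_rpow (by linarith) (by linarith) (by positivity)
    gcongr
  obtain ⟨γ₁, hγ₁, -, hg₁, hl₁⟩ := exists_path_of_holderNorm_le hM hc.holder hs hst
    (htu.le.trans hu)
  obtain ⟨γ₂, hγ₂, h0, hg₂, hl₂⟩ := exists_path_of_holderNorm_le hM hc.holder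
    (hs.trans hst.le) htu hu
  have hl₁' := hl₁.trans (hlen s t le_rfl hst htu.le)
  have hl₂' := hl₂.trans (hlen t u hst.le htu le_rfl)
  -- `z` has length at most `4 * ρ` and the signatures of `x` over `[s, t]`, `[t, u]` and `[s, u]`.
  -- The solution `w` along `z` thus has small Euler errors for the very increments used by `y`.
  set z := concatPath γ₁ γ₂ with hz
  have hzL : IsLipschitzPath z 0 2 := hγ₁.concatPath hγ₂ h0
  have hS₁ : signature N z 0 1 = signature N x s t := by
    rw [hz, signature_concatPath_left, hg₁]
  have hS₂ : signature N z 1 2 = signature N x t u := by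
    rw [hz, signature_concatPath_right, hg₂]
  have hS : signature N z 0 2 = signature N x s u :=
    hzL.signature_eq_of_adjacent (hc.path.mono hs hu) zero_le_one one_le_two hst.le htu.le
      hS₁ hS₂
  have hz₁ : pathLength z 0 1 ≤ 2 * ρ := by rwa [hz, pathLength_concatPath_left]
  have hz₂ : pathLength z 1 2 ≤ 2 * ρ := by rwa [hz, pathLength_concatPath_right]
  have hz₀ : pathLength z 0 2 ≤ 4 * ρ := by
    rw [← hzL.pathLength_add (t := 1) (by simp) (by simp) (by simp)]
    linarith
  obtain ⟨w, hw⟩ := exists_isSolution zero_le_two hzL hL (by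
    rw [← hΛ]
    nlinarith [mul_le_mul_of_nonneg_left hz₀ hΛ0]) (y s)
  have hw0 : w 0 = y s := hw.apply_left zero_le_two
  set ε := E * (4 * ρ) ^ (N + 1) with hε
  have hbound : ∀ v q, 0 ≤ v → v ≤ q → q ≤ 2 → pathLength z v q ≤ 4 * ρ →
      ‖w q - w v - eulerIncrement V (w v) (signature N z v q)‖ ≤ ε := by
    intro v q hv hvq hq hl
    refine (hE z (y s) w 0 2 hzL hw v q hv hvq hq).trans ?_
    exact mul_le_mul_of_nonneg_left (pow_le_pow_left₀ (pathLength_nonneg hvq) hl _) hE0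
  have e₁ := hbound 0 1 le_rfl zero_le_one one_le_two (by linarith)
  have e₂ := hbound 1 2 zero_le_one one_le_two le_rfl (by linarith)
  have e₃ := hbound 0 2 le_rfl zero_le_two le_rfl hz₀
  rw [hS₁, hw0] at e₁
  rw [hS₂] at e₂
  rw [hS, hw0] at e₃
  have e₄ : ‖eulerIncrement V (y t) (signature N x t u) -
      eulerIncrement V (w 1) (signature N x t u)‖ ≤ A * (4 * ρ) * ‖y t - w 1‖ := by
    refine (hA _ (4 * ρ) fun k I hk => ?_).2 _ _
    rw [← hS₂]
    exact (hzL.mono zero_le_one le_rfl).abs_signature_le_of_le_one one_le_two (by linarith)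
      (by linarith) k I hk
  have e₅ : ‖y t - w 1‖ ≤ ‖eulerDefect V N x y s t‖ + ε := by
    have : y t - w 1 = eulerDefect V N x y s t -
        (w 1 - y s - eulerIncrement V (y s) (signature N x s t)) := by
      rw [eulerDefect]; abel
    rw [this]
    exact (norm_sub_le _ _).trans (by linarith)
  -- The increments of `w` telescope; apart from Euler errors along `z`, only the change of base
  -- point from `w 1` to `y t` remains.
  have hsplit : eulerDefect V N x y s u = eulerDefect V N x y s t + eulerDefect V N x y t u +
      (eulerIncrement V (y t) (signature N x t u) -
        eulerIncrement V (w 1) (signature N x t u)) -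
      (w 1 - y s - eulerIncrement V (y s) (signature N x s t)) -
      (w 2 - w 1 - eulerIncrement V (w 1) (signature N x t u)) +
      (w 2 - y s - eulerIncrement V (y s) (signature N x s u)) := by
    simp only [eulerDefect]; abel
  have htri : ∀ a b c a' b' c' : Euc e, ‖a + b + c - a' - b' + c'‖ ≤
      ‖a‖ + ‖b‖ + ‖c‖ + ‖a'‖ + ‖b'‖ + ‖c'‖ := fun a b c a' b' c' => by
    refine (norm_add_le _ _).trans (add_le_add_left ?_ _)
    refine (norm_sub_le _ _).trans (add_le_add_left ?_ _)
    exact (norm_sub_le _ _).trans (add_le_add_left norm_add₃_le _)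
  rw [hsplit]
  refine (htri _ _ _ _ _ _).trans ?_
  have hε' : ε = E * 4 ^ (N + 1) * ρ ^ (N + 1) := by rw [hε, mul_pow]; ring
  have hε0 : 0 ≤ ε := by positivity
  have hD := norm_nonneg (eulerDefect V N x y s t)
  have h6 : A * (4 * ρ) * ‖y t - w 1‖ ≤ A * (4 * ρ) * (‖eulerDefect V N x y s t‖ + ε) :=
    mul_le_mul_of_nonneg_left e₅ (by positivity)
  have h7 : A * (4 * ρ) * ε ≤ 4 * A * ε := by nlinarith [mul_nonneg hA0 hε0]
  have h8 : 0 ≤ (3 + 4 * A) * (E * 4 ^ (N + 1)) * ρ * ‖eulerDefect V N x y s t‖ := by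
    positivity
  have h9 : 0 ≤ 4 * A * ρ ^ (N + 1) := by positivity
  have h10 : (4 * A + (3 + 4 * A) * (E * 4 ^ (N + 1))) * ρ ^ (N + 1) =
      4 * A * ρ ^ (N + 1) + (3 + 4 * A) * ε := by rw [hε']; ring
  rw [h10]
  nlinarith

theorem rpow_one_div_pow {h : ℝ} (hh : 0 ≤ h) (n : ℕ) :
    (h ^ (1 / p)) ^ n = h ^ ((n : ℝ) / p) := by
  rw [← Real.rpow_natCast, ← Real.rpow_mul hh]
  congr 1
  ring

theorem self_le_rpow_one_div (hp : 1 ≤ p) {h : ℝ} (h0 : 0 ≤ h) (h1 : h ≤ 1) :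
    h ≤ h ^ (1 / p) :=
  Real.self_le_rpow_of_le_one h0 h1 ((div_le_one (by linarith)).2 hp)

/-- The Euler estimate over short intervals. -/
theorem exists_norm_eulerDefect_le_of_short (hp : 1 ≤ p) (hN : p < (N : ℝ) + 1)
    (hV : ∀ i, IsLipReg (N - 1) (V i)) :
    ∃ C ρ₀ : ℝ, 0 ≤ C ∧ 0 < ρ₀ ∧ ρ₀ ≤ 1 / 4 ∧ ∀ (M : ℝ) (x : ℝ → Euc d) (y : ℝ → Euc e),
      IsControlled V N p M x y → ∀ s t : ℝ, 0 ≤ s → s ≤ t → t ≤ 1 →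
      M * (t - s) ^ (1 / p) ≤ ρ₀ →
      ‖eulerDefect V N x y s t‖ ≤ C * (M * (t - s) ^ (1 / p)) ^ (N + 1) := by
  have hp0 : 0 < p := by linarith
  have hN1 : 1 ≤ N := by
    have : (0 : ℝ) < N := by linarith
    exact_mod_cast this
  obtain ⟨C, ρ₀, hC0, hρ₀, hρ₀', hstep⟩ := exists_norm_eulerDefect_le_add hp hN1 hV
  obtain ⟨E, hE0, hE⟩ := exists_norm_sub_eulerIncrement_le hN1 hV
  -- Halving an interval divides `ρ ^ (N + 1)` by `T = 2^((N+1)/p)`, which exceeds 2 because `N + 1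
  -- > p`.
  set T : ℝ := (2 ^ (1 / p)) ^ (N + 1) with hT
  have hT2 : 2 < T := by
    rw [hT, rpow_one_div_pow zero_le_two]
    nth_rewrite 1 [← Real.rpow_one 2]
    refine Real.rpow_lt_rpow_of_exponent_lt one_lt_two ?_
    rw [lt_div_iff₀ hp0]
    push_cast
    linarith
  have hT0 : 0 < T := by linarith
  -- Half of the gap `T - 2` is reserved for the perturbation `C * ρ`; the second cutoff on `ρ`
  -- below ensures `C * ρ ≤ (T - 2) / 2`.
  set κ := (2 + (T - 2) / 2) / T with hκ
  have hκ0 : 0 ≤ κ := div_nonneg (by linarith) hT0.le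
  have hκ1 : κ < 1 := by rw [hκ, div_lt_one hT0]; linarith
  -- `C / (1 - κ)` is the fixed point of `Q ↦ κ * Q + C`, the effect of one bisection.
  refine ⟨C / (1 - κ), min ρ₀ ((T - 2) / (2 * (C + 1))), div_nonneg hC0 (by linarith),
    lt_min hρ₀ (div_pos (by linarith) (by linarith)), (min_le_left _ _).trans hρ₀', ?_⟩
  intro M x y hc
  have hM : 0 < M := one_pos.trans_le hc.one_le
  obtain ⟨L, hL0, hL⟩ := hc.path.exists_pathLength_le
  have hEx : ∀ s t, 0 ≤ s → s ≤ t → t ≤ 1 →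
      ‖eulerDefect V N x y s t‖ ≤ E * (L * (t - s)) ^ (N + 1) := fun s t hs hst ht =>
    (hE x (y 0) y 0 1 hc.path hc.solution s t hs hst ht).trans
      (mul_le_mul_of_nonneg_left
        (pow_le_pow_left₀ (pathLength_nonneg hst) (hL s t hs hst ht) _) hE0)
  -- After `n` bisections the Lipschitz constant `L` of the path enters only through the factor `κ ^
  -- n`.
  have hQ : ∀ n : ℕ, ∀ s t : ℝ, 0 ≤ s → s ≤ t → t ≤ 1 →
      M * (t - s) ^ (1 / p) ≤ min ρ₀ ((T - 2) / (2 * (C + 1))) →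
      ‖eulerDefect V N x y s t‖ ≤ (κ ^ n * (E * L ^ (N + 1)) + C / (1 - κ)) *
        (M * (t - s) ^ (1 / p)) ^ (N + 1) := by
    intro n
    induction n with
    | zero =>
      intro s t hs hst ht _
      have h1 := self_le_rpow_one_div hp (sub_nonneg.2 hst) (by linarith)
      have h2 : t - s ≤ M * (t - s) ^ (1 / p) :=
        h1.trans (le_mul_of_one_le_left ((sub_nonneg.2 hst).trans h1) hc.one_le)
      have h3 : 0 ≤ C / (1 - κ) := div_nonneg hC0 (by linarith)
      have h4 := sub_nonneg.2 hst
      have h5 : (t - s) ^ (N + 1) ≤ (M * (t - s) ^ (1 / p)) ^ (N + 1) :=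
        pow_le_pow_left₀ h4 h2 _
      calc ‖eulerDefect V N x y s t‖ ≤ E * (L * (t - s)) ^ (N + 1) := hEx s t hs hst ht
        _ = E * L ^ (N + 1) * (t - s) ^ (N + 1) := by rw [mul_pow]; ring
        _ ≤ E * L ^ (N + 1) * (M * (t - s) ^ (1 / p)) ^ (N + 1) := by gcongr
        _ ≤ _ := by
          refine mul_le_mul_of_nonneg_right ?_ (by positivity)
          simpa using h3
    | succ n ih =>
      intro s t hs hst ht hshort
      rcases hst.eq_or_lt with rfl | hlt
      · have := hEx s s hs le_rfl ht
        rw [sub_self, mul_zero, zero_pow (Nat.succ_ne_zero _), mul_zero] at this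
        refine this.trans (mul_nonneg (add_nonneg (by positivity)
          (div_nonneg hC0 (by linarith))) (pow_nonneg (mul_nonneg hM.le ?_) _))
        exact Real.rpow_nonneg (by linarith) _
      · set ρ := M * (t - s) ^ (1 / p) with hρ
        set Q := κ ^ n * (E * L ^ (N + 1)) + C / (1 - κ) with hQdef
        have hQ0 : 0 ≤ Q := add_nonneg (by positivity) (div_nonneg hC0 (by linarith))
        have hρ0 : 0 ≤ ρ := mul_nonneg hM.le (Real.rpow_nonneg (by linarith) _)
        have hhalf : M * ((t - s) / 2) ^ (1 / p) = ρ / 2 ^ (1 / p) := by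
          rw [Real.div_rpow (by linarith) zero_le_two, hρ, mul_div_assoc]
        have hone : (1 : ℝ) ≤ 2 ^ (1 / p) := Real.one_le_rpow one_le_two (by positivity)
        have hhalf' : M * ((t - s) / 2) ^ (1 / p) ≤ min ρ₀ ((T - 2) / (2 * (C + 1))) := by
          rw [hhalf]
          exact (div_le_self hρ0 hone).trans hshort
        have i₁ := ih s ((s + t) / 2) hs (by linarith) (by linarith)
          (by rwa [show (s + t) / 2 - s = (t - s) / 2 by ring])
        have i₂ := ih ((s + t) / 2) t (by linarith) (by linarith) ht
          (by rwa [show t - (s + t) / 2 = (t - s) / 2 by ring])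
        rw [show (s + t) / 2 - s = (t - s) / 2 by ring, hhalf, div_pow, ← hT] at i₁
        rw [show t - (s + t) / 2 = (t - s) / 2 by ring, hhalf, div_pow, ← hT] at i₂
        have hs' := hstep M x y hc s ((s + t) / 2) t ρ hs (by linarith) (by linarith) ht hρ
          (hshort.trans (min_le_left _ _))
        have hCρ : C * ρ ≤ (T - 2) / 2 := by
          have h1 : ρ * (2 * (C + 1)) ≤ T - 2 := by
            rw [← le_div_iff₀ (by linarith)]
            exact hshort.trans (min_le_right _ _)
          nlinarith
        have e : κ ^ (n + 1) * (E * L ^ (N + 1)) + C / (1 - κ) = κ * Q + C := by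
          have : 1 - κ ≠ 0 := by linarith
          rw [hQdef]
          field_simp
          ring
        rw [e]
        have hR : 0 ≤ Q * (ρ ^ (N + 1) / T) := by positivity
        calc ‖eulerDefect V N x y s t‖
            ≤ (1 + C * ρ) * (Q * (ρ ^ (N + 1) / T)) + Q * (ρ ^ (N + 1) / T) +
              C * ρ ^ (N + 1) := by
              refine hs'.trans ?_
              gcongr
          _ = (2 + C * ρ) * (Q * (ρ ^ (N + 1) / T)) + C * ρ ^ (N + 1) := by ring
          _ ≤ (2 + (T - 2) / 2) * (Q * (ρ ^ (N + 1) / T)) + C * ρ ^ (N + 1) := by gcongr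
          _ = (κ * Q + C) * ρ ^ (N + 1) := by rw [hκ]; ring
  intro s t hs hst ht hshort
  have hlim : Filter.Tendsto (fun n : ℕ => (κ ^ n * (E * L ^ (N + 1)) + C / (1 - κ)) *
      (M * (t - s) ^ (1 / p)) ^ (N + 1)) Filter.atTop
      (nhds ((0 * (E * L ^ (N + 1)) + C / (1 - κ)) * (M * (t - s) ^ (1 / p)) ^ (N + 1))) :=
    (((tendsto_pow_atTop_nhds_zero_of_lt_one hκ0 hκ1).mul_const _).add_const _).mul_const _
  rw [zero_mul, zero_add] at hlim
  exact ge_of_tendsto' hlim fun n => hQ n s t hs hst ht hshort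

end LocalEstimate

/-! ### Arbitrary intervals and polynomial constants -/

section GlobalEstimate

variable {d e N : ℕ} {V : Fin d → Euc e → Euc e} {p : ℝ}

theorem norm_sub_le_of_local {E : Type} [NormedAddCommGroup E] {y : ℝ → E} {h B : ℝ}
    (hh : 0 < h) (hy : ∀ s t, 0 ≤ s → s ≤ t → t ≤ 1 → t - s ≤ h → ‖y t - y s‖ ≤ B) (n : ℕ)
    {s t : ℝ} (hs : 0 ≤ s) (hst : s ≤ t) (ht : t ≤ 1) (hn : t - s ≤ n * h) :
    ‖y t - y s‖ ≤ n * B := by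
  induction n generalizing t with
  | zero =>
    have : t = s := by
      rw [Nat.cast_zero, zero_mul] at hn
      linarith
    simp [this]
  | succ n ih =>
    have hB : 0 ≤ B := (norm_nonneg _).trans (hy 0 0 le_rfl le_rfl zero_le_one (by simpa using hh.le))
    push_cast at hn ⊢
    rcases le_total (t - h) s with hsh | hsh
    · have := hy s t hs hst ht (by linarith)
      nlinarith [mul_nonneg (Nat.cast_nonneg (α := ℝ) n) hB]
    · have h1 := ih hsh (by linarith) (by linarith)
      have h2 := hy (t - h) t (by linarith) (by linarith) ht (by linarith)
      have h3 := norm_sub_le_norm_sub_add_norm_sub (y t) (y (t - h)) (y s)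
      linarith

/-- The estimate uses a short path with the same signature, since the length of `x` itself is not
controlled by `M`. -/
theorem abs_signature_le_pow {M s t : ℝ} {x : ℝ → Euc d} {y : ℝ → Euc e}
    (hc : IsControlled V N p M x y) (hs : 0 ≤ s) (hst : s < t) (ht : t ≤ 1)
    (k : Fin (N + 1)) (I : Fin (k : ℕ) → Fin d) :
    |signature N x s t k I| ≤ (2 * (M * (t - s) ^ (1 / p))) ^ (k : ℕ) := by
  obtain ⟨γ, hγ, -, hg, hl⟩ := exists_path_of_holderNorm_le (one_pos.trans_le hc.one_le)
    hc.holder hs hst ht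
  rw [← hg]
  refine (hγ.abs_signature_le zero_le_one k I).trans
    (pow_le_pow_left₀ (pathLength_nonneg zero_le_one) ?_ _)
  rwa [← mul_assoc]

/-- Hölder and Euler estimates with constants of polynomial growth. -/
theorem exists_polynomial_davie_constant (hp : 1 ≤ p) (hN : p < (N : ℝ) + 1)
    (hV : ∀ i, IsLipReg (N - 1) (V i)) :
    ∃ c : ℝ, 0 < c ∧ ∀ (M : ℝ) (x : ℝ → Euc d) (y : ℝ → Euc e), IsControlled V N p M x y →
      (∀ s t : ℝ, 0 ≤ s → s < t → t ≤ 1 →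
        ‖y t - y s‖ < c * M ^ (2 * N + 2) * (t - s) ^ (1 / p)) ∧
      ∀ s t : ℝ, 0 ≤ s → s ≤ t → t ≤ 1 → ‖eulerDefect V N x y s t‖ ≤
        c * M ^ (2 * N + 2) * (t - s) ^ (((N : ℝ) + 1) / p) := by
  have hp0 : 0 < p := by linarith
  have hN1 : 1 ≤ N := by
    have : (0 : ℝ) < N := by linarith
    exact_mod_cast this
  obtain ⟨A, hA0, hA⟩ := exists_eulerIncrement_bounds hN1 hV
  obtain ⟨C, ρ₀, hC0, hρ₀, hρ₄, hshort⟩ := exists_norm_eulerDefect_le_of_short hp hN hV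
  -- The summands serve the increment of `y`, the Euler increment on long intervals, the defect on
  -- short ones, and the strictness of the Hölder estimate. The power of `1 / ρ₀` converts `R = M /
  -- ρ₀` back to `M`.
  refine ⟨(2 * (2 * A + C) + A * 2 ^ N + C + 1) * (1 / ρ₀) ^ (2 * N + 2), by positivity,
    fun M x y hc => ?_⟩
  have hM : 0 < M := one_pos.trans_le hc.one_le
  set R := M / ρ₀ with hR
  have hMR : M ≤ R := by
    rw [hR, le_div_iff₀ hρ₀]
    nlinarith
  have hR1 : 1 ≤ R := hc.one_le.trans hMR
  have hR0 : 0 < R := by linarith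
  have hMρ : M = R * ρ₀ := by rw [hR, div_mul_cancel₀ _ hρ₀.ne']
  have hconst : ∀ c' : ℝ, c' * (1 / ρ₀) ^ (2 * N + 2) * M ^ (2 * N + 2) =
      c' * R ^ (2 * N + 2) := fun c' => by
    rw [mul_assoc, ← mul_pow, hR]
    congr 2
    ring
  rw [hconst]
  have hpow : ∀ k ≤ 2 * N + 2, R ^ k ≤ R ^ (2 * N + 2) := fun k hk => pow_le_pow_right₀ hR1 hk
  have hinc : ∀ s t, 0 ≤ s → s ≤ t → t ≤ 1 → M * (t - s) ^ (1 / p) ≤ ρ₀ →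
      ‖y t - y s‖ ≤ (2 * A + C) * (M * (t - s) ^ (1 / p)) := by
    intro s t hs hst ht hsh
    rcases hst.eq_or_lt with rfl | hlt
    · rw [sub_self, norm_zero]
      have := Real.rpow_nonneg (sub_self s).ge (1 / p)
      positivity
    set ρ := M * (t - s) ^ (1 / p) with hρ
    have hρ0 : 0 ≤ ρ := mul_nonneg hM.le (Real.rpow_nonneg (by linarith) _)
    have h1 : ‖eulerIncrement V (y s) (signature N x s t)‖ ≤ A * (2 * ρ) := by
      refine (hA _ (2 * ρ) fun k I hk => ?_).1 _
      exact (abs_signature_le_pow hc hs hlt ht k I).trans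
        (pow_le_of_le_one (by positivity) (by linarith) hk)
    have h2 := hshort M x y hc s t hs hst ht hsh
    have h3 : ρ ^ (N + 1) ≤ ρ := pow_le_of_le_one hρ0 (by linarith) (Nat.succ_ne_zero _)
    have h4 : y t - y s = eulerDefect V N x y s t +
        eulerIncrement V (y s) (signature N x s t) := by rw [eulerDefect]; abel
    rw [h4]
    refine (norm_add_le _ _).trans ?_
    nlinarith [mul_le_mul_of_nonneg_left h3 hC0]
  -- The threshold interval length, at which `M * h₀ ^ (1 / p) = ρ₀`.
  set h₀ := R⁻¹ ^ p with hh₀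
  have hh₀0 : 0 < h₀ := Real.rpow_pos_of_pos (by positivity) _
  have hh₀p : h₀ ^ (1 / p) = R⁻¹ := by
    rw [hh₀, one_div, Real.rpow_rpow_inv (by positivity) hp0.ne']
  -- Governs the number of short pieces in a long interval: the true order `R ^ p` is rounded up to
  -- an integer power.
  have hh₀inv : h₀⁻¹ ≤ R ^ (N + 1) := by
    rw [hh₀, Real.inv_rpow hR0.le, inv_inv, ← Real.rpow_natCast]
    refine Real.rpow_le_rpow_of_exponent_le hR1 ?_
    push_cast
    exact hN.le
  have hle : ∀ {h : ℝ}, 0 ≤ h → h ≤ h₀ → M * h ^ (1 / p) ≤ ρ₀ := by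
    intro h hh hhh
    have h1 : h ^ (1 / p) ≤ R⁻¹ := hh₀p ▸ Real.rpow_le_rpow hh hhh (by positivity)
    calc M * h ^ (1 / p) ≤ M * R⁻¹ := by gcongr
      _ = ρ₀ := by rw [hMρ]; field_simp
  have hgt : ∀ {h : ℝ}, h₀ ≤ h → 1 ≤ R * h ^ (1 / p) := by
    intro h hhh
    have h1 : R⁻¹ ≤ h ^ (1 / p) := hh₀p ▸ Real.rpow_le_rpow hh₀0.le hhh (by positivity)
    calc (1 : ℝ) = R * R⁻¹ := (mul_inv_cancel₀ hR0.ne').symm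
      _ ≤ _ := by gcongr
  have hglob : ∀ s t, 0 ≤ s → s ≤ t → t ≤ 1 →
      ‖y t - y s‖ ≤ 2 * (2 * A + C) * R ^ (N + 1) * (t - s) ^ (1 / p) := by
    intro s t hs hst ht
    have hτ : 0 ≤ (t - s) ^ (1 / p) := Real.rpow_nonneg (by linarith) _
    rcases le_total (t - s) h₀ with hsh | hlong
    · refine (hinc s t hs hst ht (hle (by linarith) hsh)).trans ?_
      rw [← mul_assoc]
      refine mul_le_mul_of_nonneg_right ?_ hτ
      have h1 : R ≤ R ^ (N + 1) := le_self_pow₀ hR1 (Nat.succ_ne_zero _)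
      have h2 : (2 * A + C) * M ≤ (2 * A + C) * R ^ (N + 1) :=
        mul_le_mul_of_nonneg_left (hMR.trans h1) (by positivity)
      have h3 : 0 ≤ (2 * A + C) * R ^ (N + 1) := by positivity
      linarith
    · have hloc : ∀ s t, 0 ≤ s → s ≤ t → t ≤ 1 → t - s ≤ h₀ → ‖y t - y s‖ ≤ 2 * A + C := by
        intro s t hs hst ht hsh
        have h1 := hle (by linarith) hsh
        refine (hinc s t hs hst ht h1).trans (mul_le_of_le_one_right (by positivity) ?_)
        linarith
      have h1 : 1 ≤ (t - s) / h₀ := (one_le_div hh₀0).2 hlong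
      have h2 := norm_sub_le_of_local hh₀0 hloc ⌈(t - s) / h₀⌉₊ hs hst ht
        ((div_le_iff₀ hh₀0).1 (Nat.le_ceil _))
      have h3 : (⌈(t - s) / h₀⌉₊ : ℝ) ≤ 2 * ((t - s) / h₀) := by
        have := (Nat.ceil_lt_add_one (zero_le_one.trans h1)).le
        linarith
      have h4 : (t - s) / h₀ ≤ R ^ (N + 1) * (t - s) ^ (1 / p) := by
        rw [div_eq_mul_inv, mul_comm]
        exact mul_le_mul hh₀inv (self_le_rpow_one_div hp (by linarith) (by linarith))
          (by linarith) (by positivity)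
      calc ‖y t - y s‖ ≤ ⌈(t - s) / h₀⌉₊ * (2 * A + C) := h2
        _ ≤ 2 * (R ^ (N + 1) * (t - s) ^ (1 / p)) * (2 * A + C) := by
          refine mul_le_mul_of_nonneg_right (h3.trans ?_) (by positivity)
          linarith
        _ = _ := by ring
  have hRN : 0 < R ^ (2 * N + 2) := by positivity
  have hS : 0 ≤ A * 2 ^ N * R ^ (2 * N + 2) := by positivity
  refine ⟨fun s t hs hst ht => ?_, fun s t hs hst ht => ?_⟩
  · refine (hglob s t hs hst.le ht).trans_lt
      (mul_lt_mul_of_pos_right ?_ (Real.rpow_pos_of_pos (by linarith) _))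
    have h1 := mul_le_mul_of_nonneg_left (hpow (N + 1) (by omega))
      (show 0 ≤ 2 * (2 * A + C) by positivity)
    nlinarith [mul_nonneg hC0 hRN.le]
  · have hτ : 0 ≤ (t - s) ^ (1 / p) := Real.rpow_nonneg (by linarith) _
    have hθ : (t - s) ^ (((N : ℝ) + 1) / p) = ((t - s) ^ (1 / p)) ^ (N + 1) := by
      rw [rpow_one_div_pow (by linarith)]
      push_cast
      rfl
    rw [hθ]
    rcases le_total (t - s) h₀ with hsh | hlong
    · refine (hshort M x y hc s t hs hst ht (hle (by linarith) hsh)).trans ?_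
      rw [mul_pow, ← mul_assoc]
      refine mul_le_mul_of_nonneg_right ?_ (by positivity)
      have h1 : M ^ (N + 1) ≤ R ^ (2 * N + 2) :=
        (pow_le_pow_left₀ hM.le hMR _).trans (hpow _ (by omega))
      have h2 := mul_le_mul_of_nonneg_left h1 hC0
      have h3 : 0 ≤ (2 * (2 * A + C)) * R ^ (2 * N + 2) := by positivity
      nlinarith
    · have hlt : s < t := by linarith
      have h1 : ((t - s) ^ (1 / p)) ≤ 1 := Real.rpow_le_one (by linarith) (by linarith)
        (by positivity)
      have h2 : ‖eulerIncrement V (y s) (signature N x s t)‖ ≤ A * (2 * R) ^ N := by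
        refine (hA _ _ fun k I hk => ?_).1 _
        refine (abs_signature_le_pow hc hs hlt ht k I).trans ?_
        calc (2 * (M * (t - s) ^ (1 / p))) ^ (k : ℕ) ≤ (2 * R) ^ (k : ℕ) := by
              refine pow_le_pow_left₀ (by positivity) ?_ _
              nlinarith
          _ ≤ (2 * R) ^ N := pow_le_pow_right₀ (by linarith) (by omega)
      have h3 := hglob s t hs hst ht
      have h4 : ‖eulerDefect V N x y s t‖ ≤
          2 * (2 * A + C) * R ^ (N + 1) + A * 2 ^ N * R ^ (N + 1) := by
        refine (norm_sub_le _ _).trans (add_le_add (h3.trans ?_) (h2.trans ?_))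
        · exact mul_le_of_le_one_right (by positivity) h1
        · rw [mul_pow, ← mul_assoc]
          exact mul_le_mul_of_nonneg_left (pow_le_pow_right₀ hR1 (Nat.le_succ N))
            (by positivity)
      -- On long intervals the error is only bounded, not small; the missing power of `t - s` is
      -- bought with a second factor `R ^ (N + 1)`, whence the exponent `2 * N + 2`.
      have h5 : 1 ≤ R ^ (N + 1) * ((t - s) ^ (1 / p)) ^ (N + 1) := by
        rw [← mul_pow]
        exact one_le_pow₀ (hgt hlong)
      refine h4.trans ?_
      calc 2 * (2 * A + C) * R ^ (N + 1) + A * 2 ^ N * R ^ (N + 1)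
          = (2 * (2 * A + C) + A * 2 ^ N) * R ^ (N + 1) * 1 := by ring
        _ ≤ (2 * (2 * A + C) + A * 2 ^ N) * R ^ (N + 1) *
            (R ^ (N + 1) * ((t - s) ^ (1 / p)) ^ (N + 1)) := by gcongr
        _ = (2 * (2 * A + C) + A * 2 ^ N) * R ^ (2 * N + 2) *
            ((t - s) ^ (1 / p)) ^ (N + 1) := by ring
        _ ≤ _ := mul_le_mul_of_nonneg_right
          (mul_le_mul_of_nonneg_right (by linarith) hRN.le) (by positivity)

/-- Equal signatures and equal starting points give equal Euler increments, so the difference is the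
defect of `y` minus that of `w`; the latter is bounded by a power of the length of `z`. -/
theorem exists_polynomial_davie_geodesic_constant (hp : 1 ≤ p) (hN : p < (N : ℝ) + 1)
    (hV : ∀ i, IsLipReg (N - 1) (V i)) (K : ℝ) :
    ∃ c : ℝ, 0 < c ∧ ∀ (M : ℝ) (x : ℝ → Euc d) (y : ℝ → Euc e), IsControlled V N p M x y →
      ∀ s t : ℝ, 0 ≤ s → s ≤ t → t ≤ 1 → ∀ (z : ℝ → Euc d) (w : ℝ → Euc e),
      IsLipschitzPath z s t → signature N z s t = signature N x s t →
      pathLength z s t ≤ K * M * (t - s) ^ (1 / p) → IsSolution V z s t (y s) w →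
      ‖(y t - y s) - (w t - w s)‖ ≤
        c * M ^ (2 * N + 2) * (t - s) ^ (((N : ℝ) + 1) / p) := by
  have hN1 : 1 ≤ N := by
    have : (0 : ℝ) < N := by linarith
    exact_mod_cast this
  obtain ⟨c, hc0, hc⟩ := exists_polynomial_davie_constant hp hN hV
  obtain ⟨E, hE0, hE⟩ := exists_norm_sub_eulerIncrement_le hN1 hV
  refine ⟨c + E * |K| ^ (N + 1), by positivity, fun M x y hx s t hs hst ht z w hz hS hl hw => ?_⟩
  have hM : 0 < M := one_pos.trans_le hx.one_le
  have h1 := (hc M x y hx).2 s t hs hst ht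
  have h2 := hE z (y s) w s t hz hw s t le_rfl hst le_rfl
  rw [hS, hw.apply_left hst] at h2
  have hτ : 0 ≤ (t - s) ^ (1 / p) := Real.rpow_nonneg (by linarith) _
  have hθ : (t - s) ^ (((N : ℝ) + 1) / p) = ((t - s) ^ (1 / p)) ^ (N + 1) := by
    rw [rpow_one_div_pow (by linarith)]
    push_cast
    rfl
  have h3 : pathLength z s t ^ (N + 1) ≤
      |K| ^ (N + 1) * M ^ (2 * N + 2) * (t - s) ^ (((N : ℝ) + 1) / p) := by
    rw [hθ]
    calc pathLength z s t ^ (N + 1) ≤ (|K| * M * (t - s) ^ (1 / p)) ^ (N + 1) := by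
          refine pow_le_pow_left₀ (pathLength_nonneg hst) (hl.trans ?_) _
          gcongr
          exact le_abs_self K
      _ = |K| ^ (N + 1) * M ^ (N + 1) * ((t - s) ^ (1 / p)) ^ (N + 1) := by
          rw [mul_pow, mul_pow]
      _ ≤ _ := by
          have := pow_le_pow_right₀ hx.one_le (show N + 1 ≤ 2 * N + 2 by omega)
          gcongr
  have h4 : (y t - y s) - (w t - w s) = eulerDefect V N x y s t -
      (w t - y s - eulerIncrement V (y s) (signature N x s t)) := by
    rw [eulerDefect, hw.apply_left hst]
    abel
  rw [h4]
  refine (norm_sub_le _ _).trans ?_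
  have h5 := mul_le_mul_of_nonneg_left h3 hE0
  linarith

end GlobalEstimate

/-! ### Comparison with exponentials of squared logarithms -/

section Growth

/-- Completing the square: `q l ≤ a l² + q² / (4 a)` with `l = ln M`. -/
theorem polynomial_le_exp_log_sq {c : ℝ} (hc : 0 < c) (q : ℕ) {a : ℝ} (ha : 0 < a) :
    ∃ c' : ℝ, ∀ M : ℝ, 1 ≤ M →
      c * (max M 1) ^ q ≤ c' * Real.exp (a * (Real.log M) ^ 2) := by
  refine ⟨c * Real.exp ((q : ℝ) ^ 2 / (4 * a)), fun M hM => ?_⟩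
  have hM0 : 0 < M := by linarith
  rw [max_eq_left hM, mul_assoc, ← Real.exp_add]
  refine mul_le_mul_of_nonneg_left ?_ hc.le
  rw [← Real.exp_log (pow_pos hM0 q), Real.exp_le_exp, Real.log_pow]
  have h : (q : ℝ) ^ 2 / (4 * a) + a * Real.log M ^ 2 - q * Real.log M =
      (q - 2 * a * Real.log M) ^ 2 / (4 * a) := by
    field_simp
    ring
  have : 0 ≤ (q - 2 * a * Real.log M) ^ 2 / (4 * a) := by positivity
  linarith

/-- The logarithm is affine in `ln M`, and `ln M ≤ (ln M)²` once `M ≥ exp 1`. -/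
theorem log_polynomial_isBigO_log_sq {c : ℝ} (hc : 0 < c) (q : ℕ) :
    (fun M : ℝ => Real.log (c * (max M 1) ^ q)) =O[Filter.atTop]
      fun M : ℝ => (Real.log M) ^ 2 := by
  refine Asymptotics.IsBigO.of_bound (|Real.log c| + q) ?_
  filter_upwards [Filter.eventually_ge_atTop (Real.exp 1)] with M hM
  have hM1 : 1 ≤ M := (Real.one_le_exp zero_le_one).trans hM
  have hM0 : 0 < M := by linarith
  have hl : 1 ≤ Real.log M := (Real.le_log_iff_exp_le hM0).2 hM
  have hl2 : Real.log M ≤ Real.log M ^ 2 := by nlinarith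
  rw [max_eq_left hM1, Real.log_mul hc.ne' (by positivity), Real.log_pow,
    Real.norm_eq_abs, Real.norm_eq_abs, abs_of_nonneg (sq_nonneg (Real.log M))]
  refine (abs_add_le _ _).trans ?_
  rw [abs_of_nonneg (show 0 ≤ (q : ℝ) * Real.log M by positivity)]
  have h1 : 0 ≤ |Real.log c| := abs_nonneg _
  have h2 : (0 : ℝ) ≤ q := Nat.cast_nonneg q
  nlinarith [mul_le_mul_of_nonneg_left hl2 h2, mul_le_mul_of_nonneg_left (hl.trans hl2) h1]

end Growth

end DavieEstimate

end

theorem corollary3p3 {d e : ℕ} (p : ℝ) (hp : 1 ≤ p) (N : ℕ) (hN : p - 1 < (N : ℝ))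
    (V : Fin d → DavieEstimate.Euc e → DavieEstimate.Euc e)
    (hV : ∀ i, DavieEstimate.IsLip N (V i)) (M₂ : ℝ) :
    ∃ (C : ℝ → ℝ) (C' : ℝ → ℝ → ℝ),
      (∀ M₁ : ℝ, 0 ≤ M₁ → 0 < C M₁ ∧ DavieEstimate.IsDavieConstant p N V M₂ M₁ (C M₁)) ∧
      (∀ K : ℝ, 0 < K → ∀ M₁ : ℝ, 0 ≤ M₁ →
        0 < C' K M₁ ∧ DavieEstimate.IsDavieGeodesicConstant p N V M₂ K M₁ (C' K M₁)) ∧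
      (∃ c : ℝ, ∀ M₁ : ℝ, 1 ≤ M₁ →
        C M₁ ≤ c * Real.exp (12 * (N : ℝ) ^ 2 * (Real.log M₁) ^ 2)) ∧
      (fun M₁ : ℝ => Real.log (C M₁)) =O[Filter.atTop] (fun M₁ : ℝ => (Real.log M₁) ^ 2) ∧
      (∀ K : ℝ, 0 < K →
        (∃ c : ℝ, ∀ M₁ : ℝ, 1 ≤ M₁ →
          C' K M₁ ≤ c * Real.exp (12 * (N : ℝ) ^ 2 * (Real.log M₁) ^ 2)) ∧
        (fun M₁ : ℝ => Real.log (C' K M₁)) =O[Filter.atTop]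
          (fun M₁ : ℝ => (Real.log M₁) ^ 2)) := by
  have hN' : p < (N : ℝ) + 1 := by linarith
  have hN0 : (0 : ℝ) < N := by linarith
  have ha : (0 : ℝ) < 12 * (N : ℝ) ^ 2 := by positivity
  have hV' : ∀ i, DavieEstimate.IsLipReg (N - 1) (V i) := fun i => (hV i).isLipReg
  obtain ⟨c, hc0, hc⟩ := DavieEstimate.exists_polynomial_davie_constant hp hN' hV'
  choose c' hc'0 hc' using
    DavieEstimate.exists_polynomial_davie_geodesic_constant hp hN' hV'
  have hctrl : ∀ {M₁ : ℝ} {x : ℝ → DavieEstimate.Euc d} {y₀ : DavieEstimate.Euc e}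
      {y : ℝ → DavieEstimate.Euc e}, DavieEstimate.IsLipschitzPath x 0 1 →
      DavieEstimate.holderNorm p (DavieEstimate.signature N x) ≤ ENNReal.ofReal M₁ →
      DavieEstimate.IsSolution V x 0 1 y₀ y →
      DavieEstimate.IsControlled V N p (max M₁ 1) x y := fun hx hh hy =>
    ⟨le_max_right _ _, hx, hh.trans (ENNReal.ofReal_le_ofReal (le_max_left _ _)),
      (hy.apply_left zero_le_one).symm ▸ hy⟩
  -- The maximum with 1 covers small `M₁`, including 0: the estimates are proved for bounds at least
  -- 1, and enlarging the bound is harmless.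
  refine ⟨fun M₁ => c * (max M₁ 1) ^ (2 * N + 2), fun K M₁ => c' K * (max M₁ 1) ^ (2 * N + 2),
    fun M₁ _ => ⟨by positivity, fun x y₀ y hx hh _ hy => hc _ x y (hctrl hx hh hy)⟩,
    fun K hK M₁ _ => ⟨mul_pos (hc'0 K) (by positivity), ?_⟩,
    DavieEstimate.polynomial_le_exp_log_sq hc0 _ ha,
    DavieEstimate.log_polynomial_isBigO_log_sq hc0 _,
    fun K _ => ⟨DavieEstimate.polynomial_le_exp_log_sq (hc'0 K) _ ha,
      DavieEstimate.log_polynomial_isBigO_log_sq (hc'0 K) _⟩⟩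
  intro x y₀ y hx hh _ hy s t hs hst ht z w hz hS hl hw
  refine hc' K _ x y (hctrl hx hh hy) s t hs hst ht z w hz hS (hl.trans ?_) hw
  have := Real.rpow_nonneg (sub_nonneg.2 hst) (1 / p)
  gcongr
  exact le_max_left _ _
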